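/- Let $G$ be a finite group and let $\hat G$ be the (finite) set of equivalence classes of complex irreducible representations of $G$. For $\lambda\in\hat G$ with character $\chi_\lambda$ put $\nu(\lambda)=\frac1{|G|}\sum_{w\in G}\chi_\lambda(w^2)$, and let $\hat G_1=\{\lambda\in\hat G : \nu(\lambda)=1\}$ and $\hat G_4=\{\lambda\in\hat G : \nu(\lambda)=-1\}$. Let $S$ be a closed (connected) non-orientable surface of cross-cap genus $k\ge 1$, that is, a space homeomorphic to the sphere with $k$ cross-caps (the quotient of a $2k$-gon by the edge identifications $a_1a_1a_2a_2\cdots a_ka_k$), so that its Euler characteristic is $\chi(S)=2-k$. Then, for any base point, $$\sum_{\lambda\in\hat G_1}(\dim\lambda)^{\chi(S)}+\sum_{\lambda\in\hat G_4}(-\dim\lambda)^{\chi(S)}=|G|^{\chi(S)-1}\,|\mathrm{Hom}(\pi_1(S),G)|,$$ and $|\mathrm{Hom}(\pi_1(S),G)|$ is the number of $k$-tuples $(x_1,\dots,x_k)\in G^k$ with $x_1^2\cdots x_k^2=1$. -/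

import Mathlib

/-! ### Closed non-orientable surfaces -/

/-- The closed unit disk in `ℂ`, regarded as a `2k`-gon whose boundary circle is cut into `2k`
equal arcs. -/
abbrev PolygonDisk : Type := Metric.closedBall (0 : ℂ) 1

/-- The boundary point `exp (2πit)` of the disk. -/
noncomputable def PolygonDisk.boundary (t : ℝ) : PolygonDisk :=
  ⟨(Circle.exp (2 * Real.pi * t) : ℂ), by rw [mem_closedBall_zero_iff, Circle.norm_coe]⟩

/-- The edge identifications of the `2k`-gon with boundary word `a₁ a₁ a₂ a₂ ⋯ aₖ aₖ`: for each
`j < k` the `2j`-th and the `(2j+1)`-st boundary arcs, both traversed counterclockwise, are glued.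
(Each pair `aⱼ aⱼ` of consecutive equally oriented edges is one cross-cap.) -/
inductive CrossCapRel (k : ℕ) : PolygonDisk → PolygonDisk → Prop
  | glue (j : Fin k) (s : unitInterval) :
      CrossCapRel k
        (PolygonDisk.boundary ((2 * (j : ℝ) + (s : ℝ)) / (2 * k)))
        (PolygonDisk.boundary ((2 * (j : ℝ) + 1 + (s : ℝ)) / (2 * k)))

/-- The sphere with `k` cross-caps (for `k ≥ 1`), as the quotient space of the `2k`-gon by the
edge identifications `a₁ a₁ a₂ a₂ ⋯ aₖ aₖ`. -/
def CrossCapSurface (k : ℕ) : Type := Quot (CrossCapRel k)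

instance (k : ℕ) : TopologicalSpace (CrossCapSurface k) :=
  inferInstanceAs (TopologicalSpace (Quot (CrossCapRel k)))

/-- `S` is a closed (connected) non-orientable surface of cross-cap genus `k`: it is homeomorphic
to the sphere with `k ≥ 1` cross-caps. -/
def IsNonorientableSurface (k : ℕ) (S : Type*) [TopologicalSpace S] : Prop :=
  1 ≤ k ∧ Nonempty (S ≃ₜ CrossCapSurface k)

/-- The Euler characteristic `χ(S) = 2 - k` of a closed non-orientable surface `S` of cross-cap
genus `k` (the `2k`-gon model has one vertex, `k` edges and one face). -/
def nonorientableEulerChar (k : ℕ) : ℤ := 2 - (k : ℤ)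

/-! ### Complex irreducible representations of a finite group -/

/-- A finite-dimensional complex irreducible representation, on a coordinate space `ℂⁿ`. -/
structure ComplexIrrep (G : Type*) [Group G] where
  n : ℕ
  ρ : Representation ℂ G (Fin n → ℂ)
  irreducible : ρ.IsIrreducible

/-- Equivalence (isomorphism) of irreducible representations. -/
instance ComplexIrrep.setoid (G : Type*) [Group G] : Setoid (ComplexIrrep G) where
  r V W := Nonempty (V.ρ.Equiv W.ρ)
  iseqv :=
    { refl := fun V => ⟨Representation.Equiv.refl V.ρ⟩
      symm := fun ⟨e⟩ => ⟨e.symm⟩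
      trans := fun ⟨e⟩ ⟨f⟩ => ⟨e.trans f⟩ }

/-- `Ĝ`: the set of equivalence classes of complex irreducible representations of `G`. -/
def IrrepClass (G : Type*) [Group G] : Type _ := Quotient (ComplexIrrep.setoid G)

namespace IrrepClass

/-- The character `χ_λ` of a class `λ ∈ Ĝ`. -/
noncomputable def character {G : Type*} [Group G] (c : IrrepClass G) : G → ℂ :=
  Quotient.lift (s := ComplexIrrep.setoid G) (fun V : ComplexIrrep G => V.ρ.character)
    (fun _ _ h => h.elim fun e => Representation.char_iso e) c

/-- The dimension `dim λ` of a class `λ ∈ Ĝ`. -/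
def dim {G : Type*} [Group G] (c : IrrepClass G) : ℕ :=
  Quotient.lift (s := ComplexIrrep.setoid G) (fun V : ComplexIrrep G => V.n)
    (fun _ _ h => h.elim fun e => by simpa using e.toLinearEquiv.finrank_eq) c

/-- The Frobenius–Schur indicator `(1/|G|) ∑_{w ∈ G} χ_λ(w²)` of `λ ∈ Ĝ`. -/
noncomputable def indicator {G : Type*} [Group G] [Fintype G] (c : IrrepClass G) : ℂ :=
  (1 / (Fintype.card G : ℂ)) * ∑ w : G, c.character (w ^ 2)

open scoped Classical in
/-- Orthonormality of the irreducible characters. -/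
theorem character_orthonormal {G : Type*} [Group G] [Fintype G] (c d : IrrepClass G) :
    (Nat.card G : ℂ)⁻¹ * ∑ g : G, c.character g * d.character g⁻¹ = if d = c then 1 else 0 := by
  have : Invertible (Nat.card G : ℂ) :=
    invertibleOfNonzero (Nat.cast_ne_zero.mpr Nat.card_pos.ne')
  induction c using Quotient.inductionOn with | _ V => ?_
  induction d using Quotient.inductionOn with | _ W => ?_
  have := V.irreducible
  have := W.irreducible
  have h := Representation.char_orthonormal V.ρ W.ρ
  refine h.trans ?_
  have hiff : Nonempty (W.ρ.Equiv V.ρ) ↔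
      (Quotient.mk (ComplexIrrep.setoid G) W) = Quotient.mk (ComplexIrrep.setoid G) V :=
    (Quotient.eq (r := ComplexIrrep.setoid G)).symm
  exact if_congr hiff rfl rfl

/-- A finite group has only finitely many complex irreducible representations up to
equivalence. -/
instance finite (G : Type*) [Group G] [Finite G] : Finite (IrrepClass G) := by
  classical
  have := Fintype.ofFinite G
  have hli : LinearIndependent ℂ (fun c : IrrepClass G => c.character) := by
    rw [linearIndependent_iff']
    intro s a h d hd
    have h2 : ∀ g, ∑ c ∈ s, a c * c.character g = 0 := fun g => by
      simpa using congrFun h g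
    have h3 : ∑ c ∈ s, a c * ((Nat.card G : ℂ)⁻¹ * ∑ g : G, c.character g * d.character g⁻¹)
        = 0 := by
      calc _ = (Nat.card G : ℂ)⁻¹ * ∑ g : G, (∑ c ∈ s, a c * c.character g) * d.character g⁻¹ := by
            simp_rw [Finset.sum_mul, Finset.mul_sum]
            rw [Finset.sum_comm]
            refine Finset.sum_congr rfl fun g _ => Finset.sum_congr rfl fun c _ => by ring
        _ = 0 := by simp [h2]
    simp_rw [character_orthonormal] at h3
    simpa [hd] using h3
  exact hli.finite

end IrrepClass

/-- `Ĝ₁`: the classes of Frobenius–Schur indicator `1` (real type). -/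
def realIrreps (G : Type*) [Group G] [Fintype G] : Set (IrrepClass G) :=
  {c | c.indicator = 1}

/-- `Ĝ₄`: the classes of Frobenius–Schur indicator `-1` (quaternionic type). -/
def quaternionicIrreps (G : Type*) [Group G] [Fintype G] : Set (IrrepClass G) :=
  {c | c.indicator = -1}

/-! Both assertions rest on the presentation of the fundamental group by the `k` edge loops with the
single relation that the boundary word is trivial. Only its consequence for a finite target is
proved: homomorphisms to `G` correspond to solutions of `x₁² ⋯ xₖ² = 1`, where `xⱼ` is the inverse
of the image of the `j`-th edge loop. The inverses are there because the product in
`FundamentalGroup` is composition of paths in the opposite order.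

The relation holds since the boundary circuit bounds the polygon (`prod_map_edgeClass`). A
homomorphism is determined by its values on the edge loops because these generate: the identity of
the surface is homotopic, with the vertex fixed, to a map that lifts locally to the simply connected
polygon (`exists_collapse`), so every loop is a chain of images of paths in the polygon
(`eq_top_of_collapse`). Every solution occurs because `|G|` copies of the polygon can be glued with
the prescribed holonomies. The result is a compact Hausdorff space with a free `G`-action, hence a
covering of the surface, and its monodromy is the desired homomorphism (`exists_hom_edgeClass`).

The solutions are counted by characters. Irreducible characters span the class functions, so `∑
dim(c) χ_c` is `|G|` times the indicator function of the identity (`sum_dim_mul_character`). By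
Schur's lemma `∑ w, ρ (w ^ 2)` is the scalar `|G| ν / dim`; the trace of its `k`-th power sums the
character over all products of `k` squares (`sum_character_prod_sq`). Hence `|G|` times the number
of solutions is `|G|^k ∑ dim² (ν / dim)^k`. Finally `ν` is `0`, `1` or `-1` according to whether
there is no invariant bilinear form, a symmetric one or an alternating one
(`sum_character_sq_trichotomy`). -/

section

/-! ### Polar coordinates on the polygon and on the surface -/

open Topology

namespace CrossCapSurface

/-- The boundary circle of the `2k`-gon, with the `i`-th edge parametrized by `[i, i + 1]`. -/
noncomputable def edge (k : ℕ) (u : ℝ) : PolygonDisk := PolygonDisk.boundary (u / (2 * k))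

theorem continuous_edge (k : ℕ) : Continuous (edge k) := by
  unfold edge PolygonDisk.boundary
  refine Continuous.subtype_mk ?_ _
  fun_prop

theorem norm_edge (k : ℕ) (u : ℝ) : ‖(edge k u : ℂ)‖ = 1 := Circle.norm_coe _

theorem edge_eq_iff {k : ℕ} (hk : 1 ≤ k) {u v : ℝ} :
    edge k u = edge k v ↔ ∃ n : ℤ, u = v + n * (2 * k) := by
  have hk' : (0 : ℝ) < k := by exact_mod_cast hk
  have hpi := Real.pi_pos
  simp only [edge, PolygonDisk.boundary, Subtype.mk.injEq]
  rw [show ∀ z w : Circle, (z : ℂ) = w ↔ z = w from fun z w => Circle.coe_inj, Circle.exp_eq_exp]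
  refine exists_congr fun n => ?_
  constructor <;> intro h
  · field_simp at h
    linarith
  · rw [h]
    field_simp

theorem edge_add_period {k : ℕ} (hk : 1 ≤ k) (u : ℝ) (n : ℤ) :
    edge k (u + n * (2 * k)) = edge k u :=
  (edge_eq_iff hk).2 ⟨n, rfl⟩

theorem exists_edge_eq {k : ℕ} (hk : 1 ≤ k) {d : PolygonDisk} (hd : ‖(d : ℂ)‖ = 1) :
    ∃ u : ℝ, 0 ≤ u ∧ u < 2 * k ∧ edge k u = d := by
  have hk' : (0 : ℝ) < k := by exact_mod_cast hk
  have hpi := Real.pi_pos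
  obtain ⟨w, hw⟩ : ∃ w : ℝ, edge k w = d := by
    refine ⟨Complex.arg d / (2 * Real.pi) * (2 * k), Subtype.ext ?_⟩
    have h := Complex.norm_mul_exp_arg_mul_I (d : ℂ)
    rw [hd] at h
    simp only [edge, PolygonDisk.boundary, Circle.coe_exp]
    rw [show 2 * Real.pi * (Complex.arg d / (2 * Real.pi) * (2 * k) / (2 * k)) = Complex.arg d by
      field_simp]
    simpa using h
  have hp : (0 : ℝ) < 2 * k := by positivity
  refine ⟨toIcoMod hp 0 w, (toIcoMod_mem_Ico hp 0 w).1, by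
    simpa using (toIcoMod_mem_Ico hp 0 w).2, ?_⟩
  rw [← hw, edge_eq_iff hk]
  refine ⟨-toIcoDiv hp 0 w, ?_⟩
  have := toIcoMod_add_toIcoDiv_zsmul hp 0 w
  rw [zsmul_eq_mul] at this
  push_cast
  linarith

/-- Polar coordinates on the `2k`-gon; the radius is truncated to `[0, 1]`. -/
noncomputable def polar (k : ℕ) (a : ℝ × ℝ) : PolygonDisk :=
  ⟨((Set.projIcc (0 : ℝ) 1 zero_le_one a.1 : ℝ) : ℂ) * (edge k a.2 : ℂ), by
    rw [mem_closedBall_zero_iff, norm_mul, norm_edge, mul_one, Complex.norm_real, Real.norm_eq_abs,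
      abs_of_nonneg (Set.projIcc (0 : ℝ) 1 zero_le_one a.1).2.1]
    exact (Set.projIcc (0 : ℝ) 1 zero_le_one a.1).2.2⟩

theorem continuous_polar (k : ℕ) : Continuous (polar k) := by
  unfold polar
  refine Continuous.subtype_mk ?_ _
  have h1 : Continuous fun a : ℝ × ℝ => ((Set.projIcc (0 : ℝ) 1 zero_le_one a.1 : ℝ) : ℂ) :=
    Complex.continuous_ofReal.comp
      (continuous_subtype_val.comp (continuous_projIcc.comp continuous_fst))
  exact h1.mul (continuous_subtype_val.comp ((continuous_edge k).comp continuous_snd))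

theorem norm_polar (k : ℕ) (a : ℝ × ℝ) :
    ‖(polar k a : ℂ)‖ = Set.projIcc (0 : ℝ) 1 zero_le_one a.1 := by
  simp only [polar]
  rw [norm_mul, norm_edge, mul_one, Complex.norm_real, Real.norm_eq_abs,
    abs_of_nonneg (Set.projIcc (0 : ℝ) 1 zero_le_one a.1).2.1]

theorem polar_of_one_le {k : ℕ} {r : ℝ} (hr : 1 ≤ r) (u : ℝ) : polar k (r, u) = edge k u := by
  apply Subtype.ext
  simp [polar, Set.projIcc_of_right_le zero_le_one hr]

theorem polar_projIcc (k : ℕ) (r u : ℝ) :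
    polar k ((Set.projIcc (0 : ℝ) 1 zero_le_one r : ℝ), u) = polar k (r, u) := by
  apply Subtype.ext
  simp [polar]

theorem polar_of_nonpos {k : ℕ} {r : ℝ} (hr : r ≤ 0) (u u' : ℝ) :
    polar k (r, u) = polar k (r, u') := by
  apply Subtype.ext
  simp [polar, Set.projIcc_of_le_left zero_le_one hr]

theorem polar_eq {k : ℕ} (hk : 1 ≤ k) {a b : ℝ × ℝ} (h : polar k a = polar k b) :
    Set.projIcc (0 : ℝ) 1 zero_le_one a.1 = Set.projIcc (0 : ℝ) 1 zero_le_one b.1 ∧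
      ((Set.projIcc (0 : ℝ) 1 zero_le_one b.1 : ℝ) = 0 ∨ ∃ n : ℤ, a.2 = b.2 + n * (2 * k)) := by
  have h1 : Set.projIcc (0 : ℝ) 1 zero_le_one a.1 = Set.projIcc (0 : ℝ) 1 zero_le_one b.1 := by
    apply Subtype.ext
    rw [← norm_polar k a, ← norm_polar k b, h]
  refine ⟨h1, ?_⟩
  by_cases h0 : (Set.projIcc (0 : ℝ) 1 zero_le_one b.1 : ℝ) = 0
  · exact Or.inl h0
  · right
    have h2 := congrArg Subtype.val h
    simp only [polar, h1] at h2
    have h3 := mul_left_cancel₀ (by exact_mod_cast h0) h2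
    exact (edge_eq_iff hk).1 (Subtype.ext h3)

theorem exists_polar_eq {k : ℕ} (hk : 1 ≤ k) (d : PolygonDisk) :
    ∃ r u : ℝ, 0 ≤ r ∧ r ≤ 1 ∧ 0 ≤ u ∧ u < 2 * k ∧ polar k (r, u) = d := by
  have hk' : (0 : ℝ) < k := by exact_mod_cast hk
  have hd : ‖(d : ℂ)‖ ≤ 1 := mem_closedBall_zero_iff.1 d.2
  have hproj : (Set.projIcc (0 : ℝ) 1 zero_le_one ‖(d : ℂ)‖ : ℝ) = ‖(d : ℂ)‖ := by
    rw [Set.projIcc_of_mem zero_le_one ⟨norm_nonneg _, hd⟩]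
  by_cases h0 : (d : ℂ) = 0
  · refine ⟨0, 0, le_rfl, zero_le_one, le_rfl, by positivity, Subtype.ext ?_⟩
    simp [polar, h0]
  · have hn : ‖(d : ℂ)‖ ≠ 0 := norm_ne_zero_iff.2 h0
    have h1 : ‖(d : ℂ) / (‖(d : ℂ)‖ : ℂ)‖ = 1 := by
      rw [norm_div, Complex.norm_real, norm_norm, div_self hn]
    obtain ⟨u, hu0, hu1, hu⟩ := exists_edge_eq hk
      (d := ⟨(d : ℂ) / (‖(d : ℂ)‖ : ℂ), mem_closedBall_zero_iff.2 h1.le⟩) h1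
    refine ⟨‖(d : ℂ)‖, u, norm_nonneg _, hd, hu0, hu1, Subtype.ext ?_⟩
    simp only [polar, hproj, hu]
    exact mul_div_cancel₀ _ (by exact_mod_cast hn)

/-- A compact rectangle already surjects onto the Hausdorff disk, so the restriction to it is a
quotient map, and this passes to the whole plane. -/
theorem isQuotientMap_polar {k : ℕ} (hk : 1 ≤ k) : IsQuotientMap (polar k) := by
  have h : IsQuotientMap (polar k ∘ ((↑) : (Set.Icc (0 : ℝ) 1 ×ˢ Set.Icc (0 : ℝ) (2 * k) : Set (ℝ × ℝ))
      → ℝ × ℝ)) := by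
    have : CompactSpace (Set.Icc (0 : ℝ) 1 ×ˢ Set.Icc (0 : ℝ) (2 * k) : Set (ℝ × ℝ)) :=
      isCompact_iff_compactSpace.1 (isCompact_Icc.prod isCompact_Icc)
    refine IsQuotientMap.of_surjective_continuous (fun d => ?_)
      ((continuous_polar k).comp continuous_subtype_val)
    obtain ⟨r, u, h1, h2, h3, h4, h5⟩ := exists_polar_eq hk d
    exact ⟨⟨(r, u), ⟨h1, h2⟩, h3, h4.le⟩, h5⟩
  exact IsQuotientMap.of_comp continuous_subtype_val (continuous_polar k) h

/-- The projection of the `2k`-gon to the surface. -/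
def proj (k : ℕ) : C(PolygonDisk, CrossCapSurface k) :=
  ⟨Quot.mk _, continuous_quot_mk⟩

theorem isQuotientMap_proj (k : ℕ) : IsQuotientMap (proj k) := isQuotientMap_quot_mk

/-- Polar coordinates on the surface. -/
noncomputable def chart (k : ℕ) (a : ℝ × ℝ) : CrossCapSurface k := proj k (polar k a)

theorem isQuotientMap_chart {k : ℕ} (hk : 1 ≤ k) : IsQuotientMap (chart k) :=
  (isQuotientMap_proj k).comp (isQuotientMap_polar hk)

theorem proj_edge_add_one_nat {k : ℕ} (j : Fin k) (s : unitInterval) :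
    proj k (edge k (2 * (j : ℝ) + 1 + (s : ℝ))) = proj k (edge k (2 * (j : ℝ) + (s : ℝ))) :=
  (Quot.sound (CrossCapRel.glue j s)).symm

/-- The gluing is defined for edge indices below `k`; reducing `n` modulo `k` and using the period
`2k` of `edge` extends it to all integers. -/
theorem proj_edge_add_one {k : ℕ} (hk : 1 ≤ k) (n : ℤ) {s : ℝ} (hs : s ∈ Set.Icc (0 : ℝ) 1) :
    proj k (edge k (2 * n + 1 + s)) = proj k (edge k (2 * n + s)) := by
  have hk' : (0 : ℤ) < k := by exact_mod_cast hk
  have h1 := Int.emod_nonneg n hk'.ne'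
  have h2 := Int.emod_lt_of_pos n hk'
  have h3 := Int.emod_add_mul_ediv n k
  obtain ⟨j, hj⟩ := Int.eq_ofNat_of_zero_le h1
  have hn : (n : ℝ) = j + k * (n / (k : ℤ) : ℤ) := by
    rw [hj] at h3
    exact_mod_cast h3.symm
  have h := proj_edge_add_one_nat (k := k) ⟨j, by omega⟩ ⟨s, hs⟩
  have e1 := edge_add_period hk (2 * (j : ℝ) + 1 + s) (n / (k : ℤ))
  have e2 := edge_add_period hk (2 * (j : ℝ) + s) (n / (k : ℤ))
  rw [show 2 * (n : ℝ) + 1 + s = 2 * (j : ℝ) + 1 + s + (n / (k : ℤ) : ℤ) * (2 * k) by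
    rw [hn]; ring, show 2 * (n : ℝ) + s = 2 * (j : ℝ) + s + (n / (k : ℤ) : ℤ) * (2 * k) by
    rw [hn]; ring, e1, e2]
  exact h

/-- The hypotheses list all identifications made by `chart`: truncation of the radius, collapse of
the angle at the centre, periodicity, and the gluing of edges. Continuity is left to the quotient
property of `chart`. -/
theorem exists_lift {k : ℕ} (hk : 1 ≤ k) {Y : Type*} (F : ℝ × ℝ → Y)
    (h1 : ∀ r u, F ((Set.projIcc (0 : ℝ) 1 zero_le_one r : ℝ), u) = F (r, u))
    (h2 : ∀ u u', F (0, u) = F (0, u'))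
    (h3 : ∀ r u (n : ℤ), F (r, u + n * (2 * k)) = F (r, u))
    (h4 : ∀ (n : ℤ), ∀ s ∈ Set.Icc (0 : ℝ) 1, F (1, 2 * n + 1 + s) = F (1, 2 * n + s)) :
    ∃ f : CrossCapSurface k → Y, ∀ a, f (chart k a) = F a := by
  have hF : ∀ a b, polar k a = polar k b → F a = F b := by
    rintro ⟨r, u⟩ ⟨r', u'⟩ hab
    obtain ⟨h5, h6⟩ := polar_eq hk hab
    simp only at h5 h6
    rw [← h1 r, ← h1 r', h5]
    rcases h6 with h6 | ⟨n, rfl⟩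
    · rw [h6, h2]
    · rw [h3]
  have hs := (isQuotientMap_polar hk).surjective
  have hG : ∀ a, F (Function.surjInv hs (polar k a)) = F a := fun a =>
    hF _ _ (Function.surjInv_eq hs _)
  refine ⟨Quot.lift (fun d => F (Function.surjInv hs d)) ?_, fun a => hG a⟩
  rintro _ _ ⟨j, s⟩
  have := h4 j s s.2
  change F (Function.surjInv hs (edge k _)) = F (Function.surjInv hs (edge k _))
  rw [← polar_of_one_le le_rfl, ← polar_of_one_le le_rfl, hG, hG]
  exact_mod_cast this.symm

/-- The common image of the vertices of the `2k`-gon. -/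
noncomputable abbrev vertex (k : ℕ) : CrossCapSurface k := proj k (edge k 0)

theorem proj_edge_int {k : ℕ} (hk : 1 ≤ k) (n : ℤ) : proj k (edge k n) = vertex k := by
  have hstep : ∀ n : ℤ, proj k (edge k ((n + 1 : ℤ) : ℝ)) = proj k (edge k n) := by
    intro n
    rcases Int.even_or_odd' n with ⟨m, rfl | rfl⟩
    · have := proj_edge_add_one hk m (s := 0) ⟨le_rfl, zero_le_one⟩
      push_cast
      simpa using this
    · have := proj_edge_add_one hk m (s := 1) ⟨zero_le_one, le_rfl⟩
      push_cast
      exact this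
  induction n using Int.induction_on with
  | zero => simp [vertex]
  | succ i ih => rw [hstep, ih]
  | pred i ih => rw [← ih, ← hstep]; simp

theorem polar_add_period {k : ℕ} (hk : 1 ≤ k) (r u : ℝ) (n : ℤ) :
    polar k (r, u + n * (2 * k)) = polar k (r, u) := by
  apply Subtype.ext
  simp only [polar, edge_add_period hk]

end CrossCapSurface

end

/-! ### A homotopy from the identity to a map that lifts locally to the polygon -/

section

open Topology

namespace CrossCapSurface

/-- A piecewise linear self-map of `[0, 1]` that is constant near both end points. -/
noncomputable def plateau (s : ℝ) : ℝ := Set.projIcc (0 : ℝ) 1 zero_le_one (2 * s - 1 / 2)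

theorem continuous_plateau : Continuous plateau := by
  unfold plateau
  exact continuous_subtype_val.comp (continuous_projIcc.comp (by fun_prop))

theorem plateau_mem (s : ℝ) : plateau s ∈ Set.Icc (0 : ℝ) 1 := Subtype.property _

theorem plateau_of_le {s : ℝ} (h : s ≤ 1 / 4) : plateau s = 0 := by
  simp only [plateau]
  rw [Set.projIcc_of_le_left zero_le_one (by linarith)]

theorem plateau_of_ge {s : ℝ} (h : 3 / 4 ≤ s) : plateau s = 1 := by
  simp only [plateau]
  rw [Set.projIcc_of_right_le zero_le_one (by linarith)]

/-- The displacement of the self-map of `ℝ` that acts as `plateau` on each unit interval. -/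
noncomputable def drift (u : ℝ) : ℝ := plateau (Int.fract u) - Int.fract u

theorem continuous_drift : Continuous drift := by
  refine ContinuousOn.comp_fract'' (f := fun s => plateau s - s)
    (continuous_plateau.sub continuous_id).continuousOn ?_
  simp only [plateau_of_le (show (0 : ℝ) ≤ 1 / 4 by norm_num),
    plateau_of_ge (show (3 / 4 : ℝ) ≤ 1 by norm_num)]
  norm_num

theorem drift_int_add (n : ℤ) {s : ℝ} (hs : s ∈ Set.Icc (0 : ℝ) 1) :
    drift (n + s) = plateau s - s := by
  rcases hs.2.lt_or_eq with h | rfl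
  · simp only [drift]
    rw [Int.fract_intCast_add, Int.fract_eq_self.2 ⟨hs.1, h⟩]
  · have : Int.fract ((n : ℝ) + 1) = 0 := by simp
    simp only [drift, this, plateau_of_le (show (0 : ℝ) ≤ 1 / 4 by norm_num),
      plateau_of_ge (show (3 / 4 : ℝ) ≤ 1 by norm_num)]
    norm_num

theorem drift_add_int (u : ℝ) (n : ℤ) : drift (u + n) = drift u := by
  simp [drift]

theorem polar_congr {k : ℕ} {r r' : ℝ} (h : Set.projIcc (0 : ℝ) 1 zero_le_one r =
    Set.projIcc (0 : ℝ) 1 zero_le_one r') (u : ℝ) : polar k (r, u) = polar k (r', u) := by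
  rw [← polar_projIcc, h, polar_projIcc]

theorem projIcc_scale {c : ℝ} (hc : 1 ≤ c) (r : ℝ) :
    Set.projIcc (0 : ℝ) 1 zero_le_one (c * (Set.projIcc (0 : ℝ) 1 zero_le_one r : ℝ)) =
      Set.projIcc (0 : ℝ) 1 zero_le_one (c * r) := by
  rcases le_total r 0 with h | h
  · rw [Set.projIcc_of_le_left zero_le_one h, Set.projIcc_of_le_left zero_le_one (by simp),
      Set.projIcc_of_le_left zero_le_one (by nlinarith)]
  · rcases le_total r 1 with h' | h'
    · rw [Set.projIcc_of_mem zero_le_one ⟨h, h'⟩]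
    · rw [Set.projIcc_of_right_le zero_le_one h', Set.projIcc_of_right_le zero_le_one (by simpa),
        Set.projIcc_of_right_le zero_le_one (by nlinarith)]

/-- Stretching the radius pushes an outer annulus onto the boundary, while the drift pushes the ends
of each edge into the vertices. The gluing is respected because the drift depends only on the
position within an edge and never leaves that edge. -/
theorem exists_deformation {k : ℕ} (hk : 1 ≤ k) :
    ∃ F : C(unitInterval × CrossCapSurface k, CrossCapSurface k),
      ∀ (t : unitInterval) (r u : ℝ),
        F (t, chart k (r, u)) = chart k ((1 + t) * r, u + t * drift u) := by
  have h : ∀ t : unitInterval, ∃ f : CrossCapSurface k → CrossCapSurface k,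
      ∀ a : ℝ × ℝ, f (chart k a) = chart k ((1 + t) * a.1, a.2 + t * drift a.2) := by
    intro t
    have ht0 : (0 : ℝ) ≤ t := t.2.1
    have ht1 : (t : ℝ) ≤ 1 := t.2.2
    refine exists_lift hk _ ?_ ?_ ?_ ?_
    · intro r u
      simp only [chart]
      rw [polar_congr (projIcc_scale (by linarith) r)]
    · intro u u'
      simp only [chart, mul_zero]
      rw [polar_of_nonpos le_rfl]
    · intro r u n
      simp only [chart]
      have := drift_add_int u (n * (2 * k))
      push_cast at this
      rw [this, add_right_comm, polar_add_period hk]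
    · intro n s hs
      have e1 := drift_int_add (2 * n + 1) hs
      have e2 := drift_int_add (2 * n) hs
      push_cast at e1 e2
      simp only [chart, e1, e2]
      rw [polar_of_one_le (by linarith), polar_of_one_le (by linarith)]
      have hp := plateau_mem s
      -- The new parameter is a convex combination of `s` and `plateau s`, hence still lies in `[0,
      -- 1]`.
      have := proj_edge_add_one hk n (s := s + t * (plateau s - s))
        ⟨by nlinarith [hs.1, hs.2, hp.1, hp.2], by nlinarith [hs.1, hs.2, hp.1, hp.2]⟩
      simpa only [add_assoc] using this
  choose f hf using h
  refine ⟨⟨fun p => f p.1 p.2, ?_⟩, fun t r u => hf t (r, u)⟩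
  -- Since the interval is locally compact, joint continuity can be tested in polar coordinates.
  refine (isQuotientMap_chart hk).continuous_lift_prod_right ?_
  simp only [hf]
  have := continuous_drift
  exact (isQuotientMap_chart hk).continuous.comp (by fun_prop)

-- Produces an open set and a local lift of `f` from data in polar coordinates. The domain and the
-- lift descend together as one function with values in `Option PolygonDisk`, where `none` marks the
-- complement of the domain.
open scoped Classical in
theorem exists_local_section {k : ℕ} (hk : 1 ≤ k) (f : CrossCapSurface k → CrossCapSurface k)
    (P : ℝ × ℝ → Prop) (g : ℝ × ℝ → PolygonDisk)
    (hP : IsOpen {a | P a}) (hg : ∀ a, P a → ContinuousAt g a)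
    (hfg : ∀ a, P a → proj k (g a) = f (chart k a))
    (h1 : ∀ r u, (P ((Set.projIcc (0 : ℝ) 1 zero_le_one r : ℝ), u) ↔ P (r, u)) ∧
      (P (r, u) → g ((Set.projIcc (0 : ℝ) 1 zero_le_one r : ℝ), u) = g (r, u)))
    (h2 : ∀ u u', (P (0, u) ↔ P (0, u')) ∧ (P (0, u) → g (0, u) = g (0, u')))
    (h3 : ∀ r u (n : ℤ), (P (r, u + n * (2 * k)) ↔ P (r, u)) ∧
      (P (r, u) → g (r, u + n * (2 * k)) = g (r, u)))
    (h4 : ∀ (n : ℤ), ∀ s ∈ Set.Icc (0 : ℝ) 1, (P (1, 2 * n + 1 + s) ↔ P (1, 2 * n + s)) ∧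
      (P (1, 2 * n + s) → g (1, 2 * n + 1 + s) = g (1, 2 * n + s))) :
    ∃ (W : Set (CrossCapSurface k)) (g' : CrossCapSurface k → PolygonDisk),
      IsOpen W ∧ (∀ a, P a → chart k a ∈ W) ∧ ContinuousOn g' W ∧ ∀ y ∈ W, proj k (g' y) = f y := by
  have aux : ∀ a b, (P b ↔ P a) ∧ (P a → g b = g a) →
      (if P b then some (g b) else none) = if P a then some (g a) else none := by
    rintro a b ⟨h, h'⟩
    by_cases ha : P a
    · rw [if_pos ha, if_pos (h.2 ha), h' ha]
    · rw [if_neg ha, if_neg (mt h.1 ha)]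
  obtain ⟨G, hG⟩ := exists_lift hk (fun a => if P a then some (g a) else none)
    (fun r u => aux _ _ (h1 r u)) (fun u u' => aux _ _ (by
      refine ⟨(h2 u' u).1.symm, fun h => ((h2 u' u).2 h).symm⟩)) (fun r u n => aux _ _ (h3 r u n))
    (fun n s hs => aux _ _ (h4 n s hs))
  have hW : ∀ a, (G (chart k a) ≠ none ↔ P a) := by
    intro a
    rw [hG]
    by_cases ha : P a <;> simp [ha]
  have hg' : ∀ a, P a → (G (chart k a)).getD (edge k 0) = g a := by
    intro a ha
    simp [hG, ha]
  have hopen : IsOpen {x | G x ≠ none} := by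
    rw [← (isQuotientMap_chart hk).isOpen_preimage]
    convert hP using 1
    ext a
    exact hW a
  refine ⟨{x | G x ≠ none}, fun x => (G x).getD (edge k 0), hopen, fun a ha => (hW a).2 ha, ?_, ?_⟩
  · rw [(isQuotientMap_chart hk).continuousOn_isOpen_iff hopen]
    intro a ha
    have ha' : P a := (hW a).1 ha
    refine ((hg a ha').congr ?_).continuousWithinAt
    filter_upwards [hP.mem_nhds ha'] with b hb
    exact (hg' b hb).symm
  · intro y hy
    obtain ⟨a, rfl⟩ := (isQuotientMap_chart hk).surjective y
    have ha : P a := (hW a).1 hy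
    simp only [hg' a ha, hfg a ha]

theorem add_drift (u : ℝ) : u + drift u = ⌊u⌋ + plateau (Int.fract u) := by
  have := Int.floor_add_fract u
  simp only [drift]
  linarith

/-- The projection of the polygon has no continuous section near the glued boundary. At time `1` a
neighbourhood of the boundary has been flattened onto the edges and a neighbourhood of the vertex
onto the vertex, so one copy of each edge suffices for a lift. -/
theorem exists_collapse {k : ℕ} (hk : 1 ≤ k) :
    ∃ F : C(unitInterval × CrossCapSurface k, CrossCapSurface k),
      (∀ x, F (0, x) = x) ∧ (∀ t, F (t, vertex k) = vertex k) ∧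
      ∀ x, ∃ (W : Set (CrossCapSurface k)) (g : CrossCapSurface k → PolygonDisk),
        IsOpen W ∧ x ∈ W ∧ ContinuousOn g W ∧ ∀ y ∈ W, proj k (g y) = F (1, y) := by
  obtain ⟨F, hF⟩ := exists_deformation hk
  have hτ : Continuous fun u : ℝ => |Int.fract u - 1 / 2| :=
    ContinuousOn.comp_fract'' (f := fun s : ℝ => |s - 1 / 2|)
      (by fun_prop : Continuous fun s : ℝ => |s - 1 / 2|).continuousOn (by norm_num)
  have hfr : ∀ u (n : ℤ), Int.fract (u + n * (2 * k) : ℝ) = Int.fract u := by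
    intro u n
    have := Int.fract_add_intCast u (n * (2 * k))
    push_cast at this
    exact this
  have hfr' : ∀ s (n : ℤ), Int.fract (2 * n + 1 + s : ℝ) = Int.fract (2 * n + s : ℝ) := by
    intro s n
    have e1 := Int.fract_intCast_add (2 * n + 1) s
    have e2 := Int.fract_intCast_add (2 * n) s
    push_cast at e1 e2
    rw [e1, e2]
  have hhalf : ∀ r : ℝ, (1 / 2 : ℝ) < (Set.projIcc (0 : ℝ) 1 zero_le_one r : ℝ) ↔ 1 / 2 < r := by
    intro r
    rw [Set.coe_projIcc]
    constructor
    · intro h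
      rcases le_max_iff.1 h.le with h' | h'
      · norm_num at h'
      · by_contra hr
        have : max 0 (min 1 r) ≤ 1 / 2 := max_le (by norm_num) ((min_le_right _ _).trans (by linarith))
        linarith
    · intro h
      exact lt_max_of_lt_right (lt_min (by norm_num) h)
  have hF1 : ∀ a : ℝ × ℝ, F (1, chart k a) = chart k (2 * a.1, ⌊a.2⌋ + plateau (Int.fract a.2)) := by
    rintro ⟨r, u⟩
    have := hF 1 r u
    rw [this, ← add_drift]
    norm_num
  refine ⟨F, ?_, ?_, ?_⟩
  · intro x
    obtain ⟨⟨r, u⟩, rfl⟩ := (isQuotientMap_chart hk).surjective x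
    rw [hF]
    simp
  · intro t
    have ht0 : (0 : ℝ) ≤ t := t.2.1
    have hv : vertex k = chart k (1, 0) := by
      simp only [vertex, chart]
      rw [polar_of_one_le le_rfl]
    have hd : drift 0 = 0 := by
      simp [drift, plateau_of_le (show (0 : ℝ) ≤ 1 / 4 by norm_num)]
    rw [hv, hF, hd]
    simp only [chart]
    rw [polar_of_one_le (by linarith), polar_of_one_le le_rfl]
    simp
  · have c1 := exists_local_section hk (fun x => F (1, x)) (fun a => a.1 < 1)
      (fun a => polar k (2 * a.1, a.2 + drift a.2))
      (isOpen_lt continuous_fst continuous_const)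
      (fun a _ => by
        have := continuous_drift
        exact ((continuous_polar k).comp (by fun_prop)).continuousAt)
      (fun a _ => by rw [hF1, ← add_drift]; rfl)
      (fun r u => by
        refine ⟨?_, fun _ => polar_congr (projIcc_scale (by norm_num) r) _⟩
        simp only [Set.coe_projIcc]
        rw [max_lt_iff, min_lt_iff]
        simp)
      (fun u u' => ⟨by simp, fun _ => polar_of_nonpos (by simp) _ _⟩)
      (fun r u n => ⟨Iff.rfl, fun _ => by
        have := drift_add_int u (n * (2 * k))
        push_cast at this
        simp only [this, add_right_comm u, polar_add_period hk]⟩)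
      (fun n s hs => ⟨by simp, fun h => absurd h (by simp)⟩)
    -- Near the vertex: radius above `1/2` is doubled past `1`, and within `1/4` of the end of an
    -- edge `plateau` is constant, so the image is the vertex alone.
    have c2 := exists_local_section hk (fun x => F (1, x))
      (fun a => 1 / 2 < a.1 ∧ 1 / 4 < |Int.fract a.2 - 1 / 2|)
      (fun a => edge k 0)
      ((isOpen_lt continuous_const continuous_fst).inter
        (isOpen_lt continuous_const (hτ.comp continuous_snd)))
      (fun a _ => continuousAt_const)
      (fun a ha => by
        rw [hF1, chart, polar_of_one_le (by linarith [ha.1])]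
        rcases lt_abs.1 ha.2 with h | h
        · rw [plateau_of_ge (by linarith)]
          exact_mod_cast (proj_edge_int hk (⌊a.2⌋ + 1)).symm
        · rw [plateau_of_le (by linarith), add_zero]
          exact (proj_edge_int hk ⌊a.2⌋).symm)
      (fun r u => ⟨by simp only [hhalf], fun _ => rfl⟩)
      (fun u u' => ⟨by norm_num, fun _ => rfl⟩)
      (fun r u n => ⟨by simp only [hfr], fun _ => rfl⟩)
      (fun n s hs => ⟨by simp only [hfr'], fun _ => rfl⟩)
    -- Near the interior of an edge: the image lies on the edge, and the lift always takes the first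
    -- of the two glued arcs, the one with even index.
    have c3 := exists_local_section hk (fun x => F (1, x))
      (fun a => 1 / 2 < a.1 ∧ |Int.fract a.2 - 1 / 2| < 1 / 2)
      (fun a => edge k (2 * (⌊a.2⌋ / 2 : ℤ) + plateau (Int.fract a.2)))
      ((isOpen_lt continuous_const continuous_fst).inter
        (isOpen_lt (hτ.comp continuous_snd) continuous_const))
      (fun a ha => by
        have hpos : 0 < Int.fract a.2 := by linarith [(abs_lt.1 ha.2).1]
        have hcont : ContinuousAt (fun b : ℝ × ℝ =>
            edge k (2 * (⌊a.2⌋ / 2 : ℤ) + plateau (b.2 - ⌊a.2⌋))) a := by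
          have := continuous_edge k
          have := continuous_plateau
          fun_prop
        refine hcont.congr ?_
        have hmem : a.2 ∈ Set.Ioo (⌊a.2⌋ : ℝ) (⌊a.2⌋ + 1) :=
          ⟨by linarith [Int.floor_add_fract a.2], Int.lt_floor_add_one a.2⟩
        filter_upwards [continuous_snd.continuousAt.preimage_mem_nhds (isOpen_Ioo.mem_nhds hmem)]
          with b hb
        have : ⌊b.2⌋ = ⌊a.2⌋ := Int.floor_eq_iff.2 ⟨hb.1.le, hb.2⟩
        rw [Int.fract, this])
      (fun a ha => by
        rw [hF1, chart, polar_of_one_le (by linarith [ha.1])]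
        rcases Int.even_or_odd' ⌊a.2⌋ with ⟨q, h | h⟩
        · rw [h, show 2 * q / 2 = q by omega]
          push_cast
          rfl
        · rw [h, show (2 * q + 1) / 2 = q by omega]
          push_cast
          exact (proj_edge_add_one hk q (plateau_mem _)).symm)
      (fun r u => ⟨by simp only [hhalf], fun _ => rfl⟩)
      (fun u u' => ⟨by norm_num, fun h => absurd h.1 (by norm_num)⟩)
      (fun r u n => ⟨by simp only [hfr], fun _ => by
        have h1 : ⌊u + n * (2 * k)⌋ = ⌊u⌋ + n * (2 * k) := by
          have := Int.floor_add_intCast u (n * (2 * k))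
          push_cast at this
          exact this
        have h2 : (⌊u⌋ + n * (2 * k)) / 2 = ⌊u⌋ / 2 + n * k := by
          rw [show ⌊u⌋ + n * (2 * (k : ℤ)) = ⌊u⌋ + (n * k) * 2 by ring,
            Int.add_mul_ediv_right _ _ (by norm_num)]
        simp only [hfr, h1, h2]
        rw [← edge_add_period hk (2 * (⌊u⌋ / 2 : ℤ) + plateau (Int.fract u)) n]
        push_cast
        ring_nf⟩)
      (fun n s hs => ⟨by simp only [hfr'], fun h => by
        have h0 : s ≠ 1 := by
          rintro rfl
          have : Int.fract (2 * n + 1 : ℝ) = 0 := by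
            have := Int.fract_intCast (R := ℝ) (2 * n + 1)
            push_cast at this
            exact this
          have h' := h.2
          rw [this] at h'
          norm_num at h'
        have hs1 : s < 1 := lt_of_le_of_ne hs.2 h0
        have f1 : ⌊(2 * n + s : ℝ)⌋ = 2 * n := by
          rw [Int.floor_eq_iff]
          push_cast
          constructor <;> linarith [hs.1]
        have f2 : ⌊(2 * n + 1 + s : ℝ)⌋ = 2 * n + 1 := by
          rw [Int.floor_eq_iff]
          push_cast
          constructor <;> linarith [hs.1]
        simp only [hfr', f1, f2]
        rw [show 2 * n / 2 = n by omega, show (2 * n + 1) / 2 = n by omega]⟩)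
    intro x
    obtain ⟨a, rfl⟩ := (isQuotientMap_chart hk).surjective x
    by_cases ha1 : a.1 < 1
    · obtain ⟨W, g, h1, h2, h3, h4⟩ := c1
      exact ⟨W, g, h1, h2 a ha1, h3, h4⟩
    · have hr : 1 / 2 < a.1 := by linarith
      by_cases ha2 : 1 / 4 < |Int.fract a.2 - 1 / 2|
      · obtain ⟨W, g, h1, h2, h3, h4⟩ := c2
        exact ⟨W, g, h1, h2 a ⟨hr, ha2⟩, h3, h4⟩
      · obtain ⟨W, g, h1, h2, h3, h4⟩ := c3
        exact ⟨W, g, h1, h2 a ⟨hr, by linarith⟩, h3, h4⟩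

end CrossCapSurface

end

/-! ### Generating the fundamental group of a quotient of a simply connected space -/

section

open Topology CategoryTheory

section Generation

variable {D X : Type*} [TopologicalSpace D] [TopologicalSpace X] [SimplyConnectedSpace D]

/-- The class in `X` of the image of any path from `d₀` to `d` in the simply connected space `D`. -/
noncomputable def imageArrow (q : C(D, X)) (d₀ d : D) :
    FundamentalGroupoid.mk (q d₀) ⟶ FundamentalGroupoid.mk (q d) :=
  (FundamentalGroupoid.map q).map (X := .mk d₀) (Y := .mk d)
    (Path.Homotopic.Quotient.mk (PathConnectedSpace.somePath d₀ d))

theorem map_eq_imageArrow (q : C(D, X)) (d₀ d : D)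
    (γ : FundamentalGroupoid.mk d₀ ⟶ FundamentalGroupoid.mk d) :
    (FundamentalGroupoid.map q).map γ = imageArrow q d₀ d := by
  unfold imageArrow
  congr 1
  exact Subsingleton.elim (α := Path.Homotopic.Quotient d₀ d) _ _

theorem imageArrow_comp (q : C(D, X)) (a b c : D) :
    imageArrow q a b ≫ imageArrow q b c = imageArrow q a c := by
  rw [← map_eq_imageArrow q a c ((show FundamentalGroupoid.mk a ⟶ .mk b from
    Path.Homotopic.Quotient.mk (PathConnectedSpace.somePath a b)) ≫
    (show FundamentalGroupoid.mk b ⟶ .mk c from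
    Path.Homotopic.Quotient.mk (PathConnectedSpace.somePath b c))), Functor.map_comp]
  rfl

/-- A path that lifts to `D` has a class depending only on the end points of the lift, because `D`
is simply connected. -/
theorem mk_eq_imageArrow {q : C(D, X)} {x y : X} (p : Path x y) (g : C(unitInterval, D))
    (h : ∀ t, q (g t) = p t) {a b : D} (ha : g 0 = a) (hb : g 1 = b) :
    (Path.Homotopic.Quotient.mk p : FundamentalGroupoid.mk x ⟶ .mk y) =
      eqToHom (congrArg _ (by rw [← ha, h, p.source])) ≫ imageArrow q a b ≫
        eqToHom (congrArg _ (by rw [← hb, h, p.target])) := by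
  obtain rfl : q (g 0) = x := (h 0).trans p.source
  obtain rfl : q (g 1) = y := (h 1).trans p.target
  subst ha hb
  have hmk : (Path.Homotopic.Quotient.mk p : FundamentalGroupoid.mk (q (g 0)) ⟶ .mk (q (g 1))) =
      imageArrow q (g 0) (g 1) := by
    rw [← map_eq_imageArrow q (g 0) (g 1)
      (Path.Homotopic.Quotient.mk ⟨g, rfl, rfl⟩ : Path.Homotopic.Quotient (g 0) (g 1))]
    refine congrArg Path.Homotopic.Quotient.mk ?_
    ext t
    exact (h t).symm
  simpa using hmk

theorem imageArrow_of_eq (q : C(D, X)) {a b c : D} (h : b = c) :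
    imageArrow q a b ≫ eqToHom (by rw [h]) = imageArrow q a c := by
  subst h
  simp

theorem imageArrow_self (q : C(D, X)) (a : D) : imageArrow q a a = 𝟙 _ := by
  rw [← map_eq_imageArrow q a a (𝟙 _), CategoryTheory.Functor.map_id]
  rfl

/-- The arrow `γ` lies in `H` after connecting its end points to the base point by images of
paths in `D`. -/
def IsConjMem (q : C(D, X)) {d₀ : D} (H : Subgroup (FundamentalGroup X (q d₀))) {x y : X}
    (γ : FundamentalGroupoid.mk x ⟶ FundamentalGroupoid.mk y) : Prop :=
  ∀ (d d' : D) (hd : q d = x) (hd' : q d' = y),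
    FundamentalGroup.fromArrow (imageArrow q d₀ d ≫ eqToHom (congrArg _ hd) ≫ γ ≫
      eqToHom (congrArg _ hd'.symm) ≫ Groupoid.inv (imageArrow q d₀ d')) ∈ H

variable {q : C(D, X)} {d₀ : D} {H : Subgroup (FundamentalGroup X (q d₀))}

/-- Multiplication in the fundamental group reverses composition of arrows, whence the order of the
two factors. -/
theorem FundamentalGroup.fromArrow_comp_mem {x : X} {H : Subgroup (FundamentalGroup X x)}
    {γ δ : FundamentalGroupoid.mk x ⟶ FundamentalGroupoid.mk x}
    (hγ : FundamentalGroup.fromArrow γ ∈ H) (hδ : FundamentalGroup.fromArrow δ ∈ H) :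
    FundamentalGroup.fromArrow (γ ≫ δ) ∈ H :=
  H.mul_mem hδ hγ

theorem IsConjMem.comp (hq : Function.Surjective q) {x y z : X}
    {γ : FundamentalGroupoid.mk x ⟶ FundamentalGroupoid.mk y}
    {δ : FundamentalGroupoid.mk y ⟶ FundamentalGroupoid.mk z}
    (hγ : IsConjMem q H γ) (hδ : IsConjMem q H δ) : IsConjMem q H (γ ≫ δ) := by
  intro d d' hd hd'
  obtain ⟨m, rfl⟩ := hq y
  have h := FundamentalGroup.fromArrow_comp_mem (hγ d m hd rfl) (hδ m d' rfl hd')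
  simpa using h

theorem isConjMem_of_lift
    (hq' : ∀ (d d' : D) (h : q d = q d'), FundamentalGroup.fromArrow
      (imageArrow q d₀ d ≫ eqToHom (congrArg _ h) ≫ Groupoid.inv (imageArrow q d₀ d')) ∈ H)
    {x y : X} (p : Path x y) (g : C(unitInterval, D)) (h : ∀ t, q (g t) = p t) :
    IsConjMem q H (x := x) (y := y) (Path.Homotopic.Quotient.mk p) := by
  obtain rfl : q (g 0) = x := (h 0).trans p.source
  obtain rfl : q (g 1) = y := (h 1).trans p.target
  have hp : (Path.Homotopic.Quotient.mk p : FundamentalGroupoid.mk (q (g 0)) ⟶ .mk (q (g 1))) =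
      imageArrow q (g 0) (g 1) := by
    simpa using mk_eq_imageArrow p g h rfl rfl
  intro d d' hd hd'
  have h1 := hq' d (g 0) hd
  have h2 := hq' (g 1) d' hd'.symm
  have h3 := FundamentalGroup.fromArrow_comp_mem h1 h2
  rw [hp]
  rw [← imageArrow_comp q d₀ (g 0) (g 1)] at h3
  simpa using h3

/-- A loop is homotopic to its image under `F (1, ·)`. By compactness that image splits into
finitely many pieces, each of which lifts to `D`. Consecutive lifts need not match, but the mismatch
at each junction is an element of the kind that `hq'` places in `H`. -/
theorem eq_top_of_collapse (hq : Function.Surjective q)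
    (hq' : ∀ (d d' : D) (h : q d = q d'), FundamentalGroup.fromArrow
      (imageArrow q d₀ d ≫ eqToHom (congrArg _ h) ≫ Groupoid.inv (imageArrow q d₀ d')) ∈ H)
    (F : C(unitInterval × X, X)) (hF0 : ∀ x, F (0, x) = x) (hFd : ∀ t, F (t, q d₀) = q d₀)
    (hF1 : ∀ x, ∃ (W : Set X) (g : X → D),
        IsOpen W ∧ x ∈ W ∧ ContinuousOn g W ∧ ∀ y ∈ W, q (g y) = F (1, y)) :
    H = ⊤ := by
  rw [eq_top_iff]
  intro γ' _
  obtain ⟨γ, rfl⟩ := Path.Homotopic.Quotient.mk_surjective γ'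
  let δ : Path (q d₀) (q d₀) :=
    { toFun := fun t => F (1, γ t)
      source' := by simp [hFd]
      target' := by simp [hFd] }
  have hhom : Path.Homotopic γ δ := by
    refine ⟨⟨⟨⟨fun p => F (p.1, γ p.2), by fun_prop⟩, fun t => hF0 _, fun t => rfl⟩, ?_⟩⟩
    rintro t s (rfl | rfl)
    · simp [hFd]
    · simp [hFd]
  have hcls : Path.Homotopic.Quotient.mk γ = Path.Homotopic.Quotient.mk δ :=
    Path.Homotopic.Quotient.eq.2 hhom
  choose W g hWo hxW hg hqg using hF1
  -- Subdivision of the interval subordinate to the cover by preimages of the sets `W x`.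
  obtain ⟨t, ht0, htm, ⟨n, hn⟩, hts⟩ := exists_monotone_Icc_subset_open_cover_unitInterval
    (c := fun x : X => γ ⁻¹' W x) (fun x => (hWo x).preimage γ.continuous)
    (fun s _ => Set.mem_iUnion.2 ⟨γ s, hxW _⟩)
  have hstep : ∀ m, IsConjMem q H (x := δ (t m)) (y := δ (t (m + 1)))
      (Path.Homotopic.Quotient.mk (δ.subpath (t m) (t (m + 1)))) := by
    intro m
    obtain ⟨x, hx⟩ := hts m
    have hmem : ∀ s, γ (Set.Icc.convexComb (t m) (t (m + 1)) s) ∈ W x := by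
      intro s
      refine hx ?_
      have := Set.mem_range_self (f := Set.Icc.convexComb (t m) (t (m + 1))) s
      rwa [Path.range_subpathAux, Set.uIcc_of_le (htm m.le_succ)] at this
    have hc : Continuous fun s => γ (Set.Icc.convexComb (t m) (t (m + 1)) s) := by fun_prop
    refine isConjMem_of_lift hq' _
      ⟨fun s => g x (γ (Set.Icc.convexComb (t m) (t (m + 1)) s)),
        (hg x).comp_continuous hc hmem⟩ (fun s => ?_)
    exact hqg x _ (hmem s)
  have hall : ∀ m, IsConjMem q H (x := δ (t 0)) (y := δ (t m))
      (Path.Homotopic.Quotient.mk (δ.subpath (t 0) (t m))) := by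
    intro m
    induction m with
    | zero =>
      obtain ⟨d, hd⟩ := hq (δ (t 0))
      refine isConjMem_of_lift hq' _ (ContinuousMap.const _ d) (fun s => ?_)
      rw [Path.subpath_self]
      exact hd
    | succ m ih =>
      have h := ih.comp hq (hstep m)
      have e : (Path.Homotopic.Quotient.mk (δ.subpath (t 0) (t (m + 1))) :
          FundamentalGroupoid.mk (δ (t 0)) ⟶ .mk (δ (t (m + 1)))) =
          (show FundamentalGroupoid.mk (δ (t 0)) ⟶ .mk (δ (t m)) from
            Path.Homotopic.Quotient.mk (δ.subpath (t 0) (t m))) ≫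
          (show FundamentalGroupoid.mk (δ (t m)) ⟶ .mk (δ (t (m + 1))) from
            Path.Homotopic.Quotient.mk (δ.subpath (t m) (t (m + 1)))) :=
        (Path.Homotopic.Quotient.eq.2 ⟨Path.Homotopy.subpathTransSubpath δ _ _ _⟩).symm
      rw [e]
      exact h
  have hfin := hall n
  rw [ht0, hn n le_rfl] at hfin
  have h := hfin d₀ d₀ δ.source.symm δ.target.symm
  rw [imageArrow_self, Path.subpath_zero_one, Path.Homotopic.Quotient.mk_cast] at h
  rw [hcls]
  have h' := FundamentalGroupoid.conj_eqToHom
    (p := (Path.Homotopic.Quotient.mk δ).cast δ.source δ.target) δ.source.symm δ.target.symm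
  rw [Path.Homotopic.Quotient.cast_cast, Path.Homotopic.Quotient.cast_rfl_rfl] at h'
  convert h using 1
  refine h'.symm.trans ?_
  simp

end Generation

end

/-! ### The edge loops: their relation, and the fact that they generate -/

section

open Topology CategoryTheory

/-- The products `1, y₀, y₀y₀, y₀y₀y₁, y₀y₀y₁y₁, …`. -/
def doubledProd {G : Type*} [Group G] (y : ℕ → G) : ℕ → G
  | 0 => 1
  | i + 1 => doubledProd y i * y (i / 2)

theorem doubledProd_two_mul {G : Type*} [Group G] (y : ℕ → G) (k : ℕ) :
    doubledProd y (2 * k) = (List.ofFn fun i : Fin k => y i ^ 2).prod := by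
  induction k with
  | zero => simp [doubledProd]
  | succ k ih =>
    rw [List.ofFn_succ_last, List.prod_append, show 2 * (k + 1) = 2 * k + 1 + 1 by ring]
    simp only [doubledProd, ih]
    rw [show (2 * k + 1) / 2 = k by omega, show 2 * k / 2 = k by omega]
    simp [pow_two, mul_assoc]

namespace CrossCapSurface

instance : SimplyConnectedSpace PolygonDisk :=
  have : ContractibleSpace PolygonDisk := Metric.contractibleSpace_closedBall zero_le_one
  inferInstance

variable {k : ℕ}

/-- The `j`-th edge of the polygon as a loop on the surface. -/
noncomputable def edgeLoop (hk : 1 ≤ k) (j : ℕ) : Path (vertex k) (vertex k) where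
  toFun s := proj k (edge k (2 * (j : ℝ) + s))
  continuous_toFun := by
    have := continuous_edge k
    fun_prop
  source' := by
    have := proj_edge_int hk (2 * j)
    push_cast at this
    simpa using this
  target' := by
    have := proj_edge_int hk (2 * j + 1)
    push_cast at this
    simpa using this

/-- The class of the `j`-th edge in the fundamental group. -/
noncomputable def edgeClass (hk : 1 ≤ k) (j : ℕ) : FundamentalGroup (CrossCapSurface k) (vertex k) :=
  FundamentalGroup.fromPath (Path.Homotopic.Quotient.mk (edgeLoop hk j))

theorem proj_edge_nat (hk : 1 ≤ k) (i : ℕ) : proj k (edge k i) = vertex k := by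
  simpa using proj_edge_int hk i

/-- The loop along the first `i` boundary arcs of the polygon. -/
noncomputable def arcsClass (hk : 1 ≤ k) (i : ℕ) :
    FundamentalGroupoid.mk (vertex k) ⟶ FundamentalGroupoid.mk (vertex k) :=
  imageArrow (proj k) (edge k 0) (edge k i) ≫ eqToHom (by rw [proj_edge_nat hk i])

theorem arcsClass_zero (hk : 1 ≤ k) : arcsClass hk 0 = 𝟙 _ := by
  unfold arcsClass
  rw [imageArrow_of_eq (proj k) (b := edge k (0 : ℕ)) (c := edge k 0) (by simp), imageArrow_self]

/-- The full boundary circuit is closed already in the polygon, which is simply connected; this is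
the defining relation. -/
theorem arcsClass_two_mul_self (hk : 1 ≤ k) : arcsClass hk (2 * k) = 𝟙 _ := by
  have : edge k ((2 * k : ℕ) : ℝ) = edge k 0 := by
    have := edge_add_period hk 0 1
    push_cast at this ⊢
    simpa using this
  unfold arcsClass
  rw [imageArrow_of_eq (proj k) this, imageArrow_self]

theorem edge_path_continuous (k : ℕ) (a b : ℝ) :
    Continuous fun s : unitInterval => edge k (a + s * b) := by
  have := continuous_edge k
  fun_prop

theorem arcsClass_succ (hk : 1 ≤ k) {i : ℕ} (hi : i / 2 < k) :
    arcsClass hk (i + 1) = arcsClass hk i ≫ edgeClass hk (i / 2) := by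
  have h : ∀ s : unitInterval, proj k (edge k (i + s * 1)) = edgeLoop hk (i / 2) s := by
    intro s
    change _ = proj k (edge k _)
    rw [mul_one]
    rcases Nat.even_or_odd' i with ⟨j, rfl | rfl⟩
    · rw [show 2 * j / 2 = j by omega]
      push_cast
      rfl
    · rw [show (2 * j + 1) / 2 = j by omega]
      have := proj_edge_add_one hk j s.2
      push_cast at this ⊢
      exact this
  have e : edgeClass hk (i / 2) = _ := mk_eq_imageArrow (q := proj k) (edgeLoop hk (i / 2))
    ⟨_, edge_path_continuous k i 1⟩ h (a := edge k i) (b := edge k ((i + 1 : ℕ) : ℝ))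
    (by simp) (by simp)
  rw [e]
  unfold arcsClass
  rw [← imageArrow_comp (proj k) (edge k 0) (edge k i) (edge k ((i + 1 : ℕ) : ℝ))]
  simp

/-- The inverses undo the reversal of order in `FundamentalGroup`, so that the word reads from left
to right as in `doubledProd`. -/
theorem map_arcsClass {G : Type*} [Group G] (hk : 1 ≤ k)
    (φ : FundamentalGroup (CrossCapSurface k) (vertex k) →* G) {i : ℕ} (hi : i ≤ 2 * k) :
    φ (arcsClass hk i) = (doubledProd (fun j => (φ (edgeClass hk j))⁻¹) i)⁻¹ := by
  induction i with
  | zero =>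
    rw [arcsClass_zero]
    simpa [doubledProd] using map_one φ
  | succ i ih =>
    rw [arcsClass_succ hk (by omega)]
    have : φ (arcsClass hk i ≫ edgeClass hk (i / 2)) =
      φ (edgeClass hk (i / 2)) * φ (arcsClass hk i) := map_mul φ _ _
    rw [this, ih (by omega)]
    simp [doubledProd]

theorem prod_map_edgeClass {G : Type*} [Group G] (hk : 1 ≤ k)
    (φ : FundamentalGroup (CrossCapSurface k) (vertex k) →* G) :
    (List.ofFn fun i : Fin k => (φ (edgeClass hk i))⁻¹ ^ 2).prod = 1 := by
  have h := map_arcsClass hk φ le_rfl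
  rw [arcsClass_two_mul_self, doubledProd_two_mul] at h
  exact inv_eq_one.1 (h.symm.trans (map_one φ))

theorem arcsClass_mem (hk : 1 ≤ k) {H : Subgroup (FundamentalGroup (CrossCapSurface k) (vertex k))}
    (hH : ∀ j < k, edgeClass hk j ∈ H) {i : ℕ} (hi : i ≤ 2 * k) :
    FundamentalGroup.fromArrow (arcsClass hk i) ∈ H := by
  induction i with
  | zero =>
    rw [arcsClass_zero]
    exact H.one_mem
  | succ i ih =>
    rw [arcsClass_succ hk (by omega)]
    exact FundamentalGroup.fromArrow_comp_mem (ih (by omega)) (hH _ (by omega))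

theorem _root_.FundamentalGroup.inv_fromArrow {X : Type*} [TopologicalSpace X] {x : X}
    (γ : FundamentalGroupoid.mk x ⟶ FundamentalGroupoid.mk x) :
    (FundamentalGroup.fromArrow γ)⁻¹ = FundamentalGroup.fromArrow (Groupoid.inv γ) :=
  rfl

theorem _root_.CategoryTheory.comp_eqToHom_comp_inv {C : Type*} [Groupoid C] {x y y' z z' : C}
    (hy : y = y') (hz : z = z') (α : x ⟶ y) (β : x ⟶ y') (σ : y' ⟶ z') :
    (α ≫ eqToHom hy ≫ σ ≫ eqToHom hz.symm) ≫ eqToHom hz ≫ Groupoid.inv (β ≫ σ) =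
      α ≫ eqToHom hy ≫ Groupoid.inv β := by
  subst hy hz
  simp [Groupoid.inv_eq_inv]

/-- It suffices to treat two glued boundary points. Sliding both back along their arcs, which have
the same image, moves them to the initial vertices, where the mismatch is a quotient of two partial
boundary words. -/
theorem imageArrow_mem (hk : 1 ≤ k) {H : Subgroup (FundamentalGroup (CrossCapSurface k) (vertex k))}
    (hH : ∀ j < k, edgeClass hk j ∈ H) (d d' : PolygonDisk) (h : proj k d = proj k d') :
    FundamentalGroup.fromArrow (imageArrow (proj k) (edge k 0) d ≫ eqToHom (congrArg _ h) ≫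
      Groupoid.inv (imageArrow (proj k) (edge k 0) d')) ∈ H := by
  have h' := h
  induction Quot.eqvGen_exact h with
  | rel d d' hr =>
    obtain ⟨j, s⟩ := hr
    have h1 := FundamentalGroup.fromArrow_comp_mem (arcsClass_mem hk hH (i := 2 * j) (by omega))
      (H.inv_mem (arcsClass_mem hk hH (i := 2 * j + 1) (by omega)))
    have hpt : ∀ t : unitInterval, proj k (edge k (((2 * j + 1 : ℕ) : ℝ) + t * s)) =
        proj k (edge k (((2 * j : ℕ) : ℝ) + t * s)) := by
      intro t
      have := proj_edge_add_one hk j (s := t * s) (t * s).2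
      push_cast at this ⊢
      exact this
    let p : Path (proj k (edge k (2 * j : ℕ))) (proj k (edge k (2 * (j : ℝ) + s))) :=
      { toFun := fun t => proj k (edge k (((2 * j : ℕ) : ℝ) + t * s))
        continuous_toFun := (proj k).continuous.comp (edge_path_continuous k _ _)
        source' := by simp
        target' := by simp }
    -- The same path `p` on the surface has two lifts, one on each of the two glued arcs.
    have e1 := mk_eq_imageArrow (q := proj k) p ⟨_, edge_path_continuous k (2 * j : ℕ) s⟩
      (fun t => rfl) (a := edge k (2 * j : ℕ)) (b := edge k (2 * (j : ℝ) + s)) (by simp) (by simp)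
    have e2 := mk_eq_imageArrow (q := proj k) p ⟨_, edge_path_continuous k (2 * j + 1 : ℕ) s⟩
      hpt (a := edge k (2 * j + 1 : ℕ)) (b := edge k (2 * (j : ℝ) + 1 + s)) (by simp) (by simp)
    simp only [eqToHom_refl, Category.id_comp, Category.comp_id] at e1
    rw [e1] at e2
    change FundamentalGroup.fromArrow (imageArrow (proj k) (edge k 0) (edge k (2 * (j : ℝ) + s)) ≫
      eqToHom (congrArg _ h) ≫
      Groupoid.inv (imageArrow (proj k) (edge k 0) (edge k (2 * (j : ℝ) + 1 + s)))) ∈ H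
    rw [← imageArrow_comp (proj k) (edge k 0) (edge k (2 * j : ℕ)) (edge k (2 * (j : ℝ) + s)),
      ← imageArrow_comp (proj k) (edge k 0) (edge k (2 * j + 1 : ℕ))
        (edge k (2 * (j : ℝ) + 1 + s)), e2]
    convert h1 using 1
    rw [FundamentalGroup.inv_fromArrow]
    refine (comp_eqToHom_comp_inv (by rw [proj_edge_nat hk, proj_edge_nat hk]) (congrArg _ h)
      _ _ _).trans ?_
    simp [arcsClass, Groupoid.inv_eq_inv]
  | refl d => simpa using H.one_mem
  | symm d d' hr ih =>
    have hh : proj k d = proj k d' := h.symm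
    have := H.inv_mem (ih hh hh)
    convert this using 1
    rw [FundamentalGroup.inv_fromArrow]
    simp [Groupoid.inv_eq_inv]
  | trans a b c h1 h2 ih1 ih2 =>
    have e1 : proj k a = proj k b := Quot.eqvGen_sound h1
    have e2 : proj k b = proj k c := Quot.eqvGen_sound h2
    have := FundamentalGroup.fromArrow_comp_mem (ih1 e1 e1) (ih2 e2 e2)
    convert this using 1
    simp

theorem eq_top_of_edgeClass_mem (hk : 1 ≤ k)
    {H : Subgroup (FundamentalGroup (CrossCapSurface k) (vertex k))}
    (hH : ∀ j < k, edgeClass hk j ∈ H) : H = ⊤ := by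
  obtain ⟨F, h0, h1, h2⟩ := exists_collapse hk
  exact eq_top_of_collapse (isQuotientMap_proj k).surjective (imageArrow_mem hk hH) F h0 h1 h2

end CrossCapSurface

end

/-! ### Gluing sheets: a normal form and the closedness of the relation -/

section

open Topology CategoryTheory

/-- The saturation of a closed set is the projection of a compact set, so the quotient map is
closed. Disjoint open sets around two classes exist by normality, and the complements of the images
of their complements separate the two points. -/
theorem t2Space_quotient_of_isClosed {K : Type*} [TopologicalSpace K] [CompactSpace K] [T2Space K]
    (s : Setoid K) (h : IsClosed {p : K × K | s p.1 p.2}) : T2Space (Quotient s) := by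
  have hmk : ∀ C : Set K, IsClosed C → IsClosed ((Quotient.mk s) '' C) := by
    intro C hC
    have hq : IsQuotientMap (Quotient.mk s) := isQuotientMap_quotient_mk'
    rw [← hq.isClosed_preimage]
    have : Quotient.mk s ⁻¹' (Quotient.mk s '' C) =
        Prod.snd '' ({p : K × K | s p.1 p.2} ∩ Prod.fst ⁻¹' C) := by
      ext x
      constructor
      · rintro ⟨c, hc, hcx⟩
        exact ⟨(c, x), ⟨Quotient.exact hcx, hc⟩, rfl⟩
      · rintro ⟨⟨c, x⟩, ⟨hcx, hc⟩, rfl⟩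
        exact ⟨c, hc, Quotient.sound hcx⟩
    rw [this]
    exact ((h.inter (hC.preimage continuous_fst)).isCompact.image continuous_snd).isClosed
  refine ⟨fun a b hab => ?_⟩
  induction a using Quotient.inductionOn with | _ a => ?_
  induction b using Quotient.inductionOn with | _ b => ?_
  have hA : ∀ a : K, IsClosed {x | s a x} := fun a =>
    h.preimage (f := fun x => (a, x)) (by fun_prop)
  have hd : Disjoint {x | s a x} {x | s b x} := by
    rw [Set.disjoint_left]
    intro x hx hx'
    exact hab (Quotient.sound (s.trans hx (s.symm hx')))
  obtain ⟨U, V, hU, hV, hAU, hBV, hUV⟩ := normal_separation (hA a) (hA b) hd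
  refine ⟨_, _, (hmk _ hU.isClosed_compl).isOpen_compl, (hmk _ hV.isClosed_compl).isOpen_compl,
    ?_, ?_, ?_⟩
  · rintro ⟨c, hc, hca⟩
    exact hc (hAU (s.symm (Quotient.exact hca)))
  · rintro ⟨c, hc, hca⟩
    exact hc (hBV (s.symm (Quotient.exact hca)))
  · rw [Set.disjoint_left]
    intro z hz hz'
    induction z using Quotient.inductionOn with | _ z => ?_
    by_cases hzU : z ∈ U
    · exact hz' ⟨z, Set.disjoint_left.1 hUV hzU, rfl⟩
    · exact hz ⟨z, hzU, rfl⟩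

namespace CrossCapSurface

variable {k : ℕ} {G : Type*} [Group G]

theorem edge_injOn (hk : 1 ≤ k) {u v : ℝ} (hu : u ∈ Set.Ico (0 : ℝ) (2 * k))
    (hv : v ∈ Set.Ico (0 : ℝ) (2 * k)) (h : edge k u = edge k v) : u = v := by
  obtain ⟨n, hn⟩ := (edge_eq_iff hk).1 h
  have hk' : (0 : ℝ) < 2 * k := by positivity
  have h1 : (n : ℝ) < 1 := by
    by_contra hc
    nlinarith [hu.1, hu.2, hv.1, hv.2]
  have h2 : (-1 : ℝ) < n := by
    by_contra hc
    nlinarith [hu.1, hu.2, hv.1, hv.2]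
  have h3 : n < 1 := by exact_mod_cast h1
  have h4 : -1 < n := by exact_mod_cast h2
  obtain rfl : n = 0 := by omega
  simpa using hn

/-- The parameter in `[0, 2k)` of a boundary point of the polygon. -/
noncomputable def angle (hk : 1 ≤ k) {d : PolygonDisk} (hd : ‖(d : ℂ)‖ = 1) : ℝ :=
  (exists_edge_eq hk hd).choose

theorem angle_mem (hk : 1 ≤ k) {d : PolygonDisk} (hd : ‖(d : ℂ)‖ = 1) :
    angle hk hd ∈ Set.Ico (0 : ℝ) (2 * k) :=
  ⟨(exists_edge_eq hk hd).choose_spec.1, (exists_edge_eq hk hd).choose_spec.2.1⟩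

theorem edge_angle (hk : 1 ≤ k) {d : PolygonDisk} (hd : ‖(d : ℂ)‖ = 1) :
    edge k (angle hk hd) = d :=
  (exists_edge_eq hk hd).choose_spec.2.2

theorem angle_edge (hk : 1 ≤ k) {u : ℝ} (hu : u ∈ Set.Ico (0 : ℝ) (2 * k)) :
    angle hk (norm_edge k u) = u :=
  edge_injOn hk (angle_mem hk _) hu (edge_angle hk _)

open scoped Classical in
/-- The representative of a boundary parameter for the edge identifications. -/
noncomputable def foldEdge (k : ℕ) (u : ℝ) : PolygonDisk :=
  if Int.fract u = 0 then edge k 0 else edge k (2 * (⌊u⌋₊ / 2 : ℕ) + Int.fract u)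

open scoped Classical in
/-- The normal form of a point of `G × PolygonDisk` for the gluing of the sheets of the covering
whose holonomy along the `j`-th edge is `y j`. -/
noncomputable def sheetNormalForm (hk : 1 ≤ k) (y : ℕ → G) (p : G × PolygonDisk) :
    G × PolygonDisk :=
  if hd : ‖(p.2 : ℂ)‖ = 1 then (p.1 * doubledProd y ⌊angle hk hd⌋₊, foldEdge k (angle hk hd)) else p

theorem sheetNormalForm_edge (hk : 1 ≤ k) (y : ℕ → G) (g : G) {u : ℝ}
    (hu : u ∈ Set.Ico (0 : ℝ) (2 * k)) :
    sheetNormalForm hk y (g, edge k u) = (g * doubledProd y ⌊u⌋₊, foldEdge k u) := by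
  rw [sheetNormalForm, dif_pos (norm_edge k u)]
  simp only [angle_edge hk hu]

theorem sheetNormalForm_mul (hk : 1 ≤ k) (y : ℕ → G) (g h : G) (d : PolygonDisk) :
    sheetNormalForm hk y (g * h, d) =
      (g * (sheetNormalForm hk y (h, d)).1, (sheetNormalForm hk y (h, d)).2) := by
  unfold sheetNormalForm
  by_cases hd : ‖(d : ℂ)‖ = 1 <;> simp [hd, mul_assoc]

/-- The case `i = 2 * k` is where the relation enters: the last vertex is the first one again, so
the holonomy around the whole boundary must be trivial. -/
theorem sheetNormalForm_vertex (hk : 1 ≤ k) {y : ℕ → G} (hy : doubledProd y (2 * k) = 1) (g : G)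
    {i : ℕ} (hi : i ≤ 2 * k) : sheetNormalForm hk y (g, edge k i) = (g * doubledProd y i, edge k 0) := by
  have hk' : (0 : ℝ) < 2 * k := by positivity
  rcases hi.lt_or_eq with h | rfl
  · have h' : (i : ℝ) < 2 * k := by exact_mod_cast h
    rw [sheetNormalForm_edge hk y g ⟨by positivity, h'⟩]
    simp [foldEdge]
  · have := edge_add_period hk 0 1
    push_cast at this ⊢
    rw [hy]
    simp only [zero_add, one_mul] at this
    rw [this, sheetNormalForm_edge hk y g ⟨le_rfl, hk'⟩]
    simp [foldEdge, doubledProd]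

theorem sheetNormalForm_arc (hk : 1 ≤ k) (y : ℕ → G) (g : G) {i : ℕ} (hi : i < 2 * k) {s : ℝ}
    (hs : s ∈ Set.Ioo (0 : ℝ) 1) : sheetNormalForm hk y (g, edge k (i + s)) =
      (g * doubledProd y i, edge k (2 * (i / 2 : ℕ) + s)) := by
  have hi' : (i : ℝ) + 1 ≤ 2 * k := by exact_mod_cast hi
  have h1 : ⌊(i + s : ℝ)⌋₊ = i := by
    rw [Nat.floor_eq_iff (by linarith [hs.1, (Nat.cast_nonneg i : (0 : ℝ) ≤ i)])]
    constructor <;> linarith [hs.1, hs.2]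
  have h2 : Int.fract (i + s : ℝ) = s := by
    rw [Int.fract_natCast_add, Int.fract_eq_self.2 ⟨hs.1.le, hs.2⟩]
  rw [sheetNormalForm_edge hk y g
    ⟨by linarith [hs.1, (Nat.cast_nonneg i : (0 : ℝ) ≤ i)], by linarith [hs.2]⟩]
  simp only [foldEdge, h1, h2, if_neg hs.1.ne']

/-- In the interior of an arc this is read off the normal form. The end points are vertices; at the
far end both sides acquire the same further factor `y j`. -/
theorem sheetNormalForm_glue (hk : 1 ≤ k) {y : ℕ → G} (hy : doubledProd y (2 * k) = 1) {g g' : G}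
    {j : ℕ} (hj : j < k) (hg : g * doubledProd y (2 * j) = g' * doubledProd y (2 * j + 1)) {s : ℝ}
    (hs : s ∈ Set.Icc (0 : ℝ) 1) : sheetNormalForm hk y (g, edge k (2 * (j : ℝ) + s)) =
      sheetNormalForm hk y (g', edge k (2 * (j : ℝ) + 1 + s)) := by
  rcases hs.1.eq_or_lt with rfl | h0
  · have e1 := sheetNormalForm_vertex hk hy g (i := 2 * j) (by omega)
    have e2 := sheetNormalForm_vertex hk hy g' (i := 2 * j + 1) (by omega)
    push_cast at e1 e2
    rw [add_zero, add_zero, e1, e2, hg]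
  · rcases hs.2.eq_or_lt with rfl | h1
    · have e1 := sheetNormalForm_vertex hk hy g (i := 2 * j + 1) (by omega)
      have e2 := sheetNormalForm_vertex hk hy g' (i := 2 * j + 1 + 1) (by omega)
      push_cast at e1 e2
      rw [e1, e2, doubledProd, doubledProd.eq_2 y (2 * j + 1), ← mul_assoc, ← mul_assoc, hg]
      rw [show (2 * j + 1) / 2 = 2 * j / 2 by omega]
    · have e1 := sheetNormalForm_arc hk y g (i := 2 * j) (by omega) ⟨h0, h1⟩
      have e2 := sheetNormalForm_arc hk y g' (i := 2 * j + 1) (by omega) ⟨h0, h1⟩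
      push_cast at e1 e2
      rw [e1, e2, hg, show (2 * j + 1) / 2 = 2 * j / 2 by omega]

theorem proj_sheetNormalForm (hk : 1 ≤ k) (y : ℕ → G) (p : G × PolygonDisk) :
    proj k (sheetNormalForm hk y p).2 = proj k p.2 := by
  unfold sheetNormalForm
  split_ifs with hd
  · conv_rhs => rw [← edge_angle hk hd]
    have hu := angle_mem hk hd
    generalize angle hk hd = u at hu
    have hf : u = ⌊u⌋₊ + Int.fract u := by
      rw [← Int.self_sub_floor, ← natCast_floor_eq_intCast_floor hu.1]
      ring
    simp only [foldEdge]
    split_ifs with h0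
    · rw [hf, h0, add_zero]
      exact (proj_edge_nat hk _).symm
    · have hs : Int.fract u ∈ Set.Icc (0 : ℝ) 1 := ⟨Int.fract_nonneg u, (Int.fract_lt_one u).le⟩
      generalize Int.fract u = f at *
      generalize ⌊u⌋₊ = i at *
      subst hf
      rcases Nat.even_or_odd' i with ⟨j, rfl | rfl⟩
      · rw [show 2 * j / 2 = j by omega]
        push_cast
        rfl
      · rw [show (2 * j + 1) / 2 = j by omega]
        have := proj_edge_add_one hk j hs
        push_cast at this ⊢
        exact this.symm
  · rfl

/-- Points over the same point of the surface differ only in the sheet, which makes the fibres of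
the covering single orbits. -/
theorem sheetNormalForm_snd_eq (hk : 1 ≤ k) {y : ℕ → G} (hy : doubledProd y (2 * k) = 1) (g g' : G)
    {d d' : PolygonDisk} (h : proj k d = proj k d') :
    (sheetNormalForm hk y (g, d)).2 = (sheetNormalForm hk y (g', d')).2 := by
  have aux : ∀ g d, (sheetNormalForm hk y (g, d)).2 = (sheetNormalForm hk y (1, d)).2 := by
    intro g d
    have := sheetNormalForm_mul hk y g 1 d
    rw [mul_one] at this
    rw [this]
  rw [aux g, aux g']
  induction Quot.eqvGen_exact h with
  | rel d d' hr =>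
    obtain ⟨j, s⟩ := hr
    have := sheetNormalForm_glue hk hy j.2 (g := (doubledProd y (2 * j))⁻¹)
      (g' := (doubledProd y (2 * j + 1))⁻¹) (by simp) s.2
    exact (aux _ _).symm.trans ((congrArg Prod.snd this).trans (aux _ _))
  | refl d => rfl
  | symm d d' h1 ih => exact (ih (Quot.eqvGen_sound h1)).symm
  | trans a b c h1 h2 ih1 ih2 =>
    exact (ih1 (Quot.eqvGen_sound h1)).trans (ih2 (Quot.eqvGen_sound h2))

/-- A converse to the gluing lemmas: the relation consists of the diagonal, finitely many pairs of
vertices, and finitely many pairs of glued arcs in either order. This explicit list is what makes it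
closed. -/
theorem eq_of_sheetNormalForm_eq (hk : 1 ≤ k) (y : ℕ → G) {g g' : G} {d d' : PolygonDisk}
    (h : sheetNormalForm hk y (g, d) = sheetNormalForm hk y (g', d')) :
    (g, d) = (g', d') ∨
    (∃ i i' : Fin (2 * k), g * doubledProd y i = g' * doubledProd y i' ∧
      d = edge k i ∧ d' = edge k i') ∨
    (∃ j : Fin k, g * doubledProd y (2 * j) = g' * doubledProd y (2 * j + 1) ∧
      ∃ s : unitInterval, d = edge k (2 * (j : ℝ) + s) ∧ d' = edge k (2 * (j : ℝ) + 1 + s)) ∨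
    (∃ j : Fin k, g' * doubledProd y (2 * j) = g * doubledProd y (2 * j + 1) ∧
      ∃ s : unitInterval, d' = edge k (2 * (j : ℝ) + s) ∧ d = edge k (2 * (j : ℝ) + 1 + s)) := by
  have hint : ∀ g (d : PolygonDisk), ‖(d : ℂ)‖ ≠ 1 → sheetNormalForm hk y (g, d) = (g, d) := by
    intro g d hd
    rw [sheetNormalForm, dif_neg hd]
  have hbd : ∀ g (d : PolygonDisk), ‖(d : ℂ)‖ = 1 →
      ‖((sheetNormalForm hk y (g, d)).2 : ℂ)‖ = 1 := by
    intro g d hd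
    rw [sheetNormalForm, dif_pos hd]
    simp only [foldEdge]
    split_ifs <;> exact norm_edge k _
  have hrep : ∀ d : PolygonDisk, ‖(d : ℂ)‖ = 1 → ∃ i : ℕ, i < 2 * k ∧
      ∃ s ∈ Set.Ico (0 : ℝ) 1, d = edge k (i + s) := by
    intro d hd
    have hu := angle_mem hk hd
    have hf : angle hk hd = ⌊angle hk hd⌋₊ + Int.fract (angle hk hd) := by
      rw [← Int.self_sub_floor, ← natCast_floor_eq_intCast_floor hu.1]
      ring
    refine ⟨⌊angle hk hd⌋₊, ?_, Int.fract (angle hk hd), ⟨Int.fract_nonneg _, Int.fract_lt_one _⟩, ?_⟩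
    · rw [Nat.floor_lt hu.1]
      exact_mod_cast hu.2
    · rw [← hf, edge_angle]
  by_cases hd : ‖(d : ℂ)‖ = 1
  · by_cases hd' : ‖(d' : ℂ)‖ = 1
    · obtain ⟨i, hi, s, hs, rfl⟩ := hrep d hd
      obtain ⟨i', hi', s', hs', rfl⟩ := hrep d' hd'
      have hz : ∀ i : ℕ, i < 2 * k → sheetNormalForm hk y (g, edge k (i + 0)) =
          (g * doubledProd y i, edge k 0) ∧ sheetNormalForm hk y (g', edge k (i + 0)) =
          (g' * doubledProd y i, edge k 0) := by
        intro i hi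
        have hi' : (i : ℝ) < 2 * k := by exact_mod_cast hi
        rw [add_zero, sheetNormalForm_edge hk y g ⟨by positivity, hi'⟩,
          sheetNormalForm_edge hk y g' ⟨by positivity, hi'⟩]
        simp [foldEdge]
      have hk' : (0 : ℝ) < 2 * k := by positivity
      have hin : ∀ i : ℕ, i < 2 * k → ∀ s ∈ Set.Ico (0 : ℝ) 1,
          (2 * (i / 2 : ℕ) + s : ℝ) ∈ Set.Ico (0 : ℝ) (2 * k) := by
        intro i hi s hs
        have : 2 * (i / 2) + 1 ≤ 2 * k := by omega
        have : (2 * (i / 2 : ℕ) + 1 : ℝ) ≤ 2 * k := by exact_mod_cast this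
        have h0 : (0 : ℝ) ≤ (i / 2 : ℕ) := Nat.cast_nonneg _
        exact ⟨by linarith [hs.1], by linarith [hs.2]⟩
      have hne : ∀ i : ℕ, i < 2 * k → ∀ s ∈ Set.Ico (0 : ℝ) 1, 0 < s →
          edge k (2 * (i / 2 : ℕ) + s) ≠ edge k 0 := by
        intro i hi s hs hs0 he
        have := edge_injOn hk (hin i hi s hs) ⟨le_rfl, hk'⟩ he
        have h0 : (0 : ℝ) ≤ (i / 2 : ℕ) := Nat.cast_nonneg _
        linarith
      rcases hs.1.eq_or_lt with rfl | h0
      · rcases hs'.1.eq_or_lt with rfl | h0'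
        · rw [(hz i hi).1, (hz i' hi').2, Prod.mk.injEq] at h
          exact Or.inr (Or.inl ⟨⟨i, hi⟩, ⟨i', hi'⟩, h.1, by simp, by simp⟩)
        · rw [(hz i hi).1, sheetNormalForm_arc hk y g' hi' ⟨h0', hs'.2⟩, Prod.mk.injEq] at h
          exact absurd h.2.symm (hne i' hi' s' hs' h0')
      · rcases hs'.1.eq_or_lt with rfl | h0'
        · rw [(hz i' hi').2, sheetNormalForm_arc hk y g hi ⟨h0, hs.2⟩, Prod.mk.injEq] at h
          exact absurd h.2 (hne i hi s hs h0)
        · rw [sheetNormalForm_arc hk y g hi ⟨h0, hs.2⟩,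
            sheetNormalForm_arc hk y g' hi' ⟨h0', hs'.2⟩, Prod.mk.injEq] at h
          have he := edge_injOn hk (hin i hi s hs) (hin i' hi' s' hs') h.2
          have hi2 : i / 2 = i' / 2 := by
            have a1 : (2 * (i / 2 : ℕ) : ℝ) < 2 * (i' / 2 : ℕ) + 1 := by
              linarith [hs.1, hs'.2]
            have a2 : (2 * (i' / 2 : ℕ) : ℝ) < 2 * (i / 2 : ℕ) + 1 := by
              linarith [hs'.1, hs.2]
            have a1' : 2 * (i / 2) < 2 * (i' / 2) + 1 := by exact_mod_cast a1
            have a2' : 2 * (i' / 2) < 2 * (i / 2) + 1 := by exact_mod_cast a2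
            omega
          obtain rfl : s = s' := by
            rw [hi2] at he
            linarith
          have hsI : s ∈ Set.Icc (0 : ℝ) 1 := ⟨hs.1, hs.2.le⟩
          rcases Nat.even_or_odd' i with ⟨j, rfl | rfl⟩ <;>
            rcases Nat.even_or_odd' i' with ⟨j', rfl | rfl⟩
          · obtain rfl : j = j' := by omega
            left
            rw [mul_right_cancel h.1]
          · obtain rfl : j = j' := by omega
            right; right; left
            exact ⟨⟨j, by omega⟩, h.1, ⟨s, hsI⟩, by push_cast; rfl, by push_cast; rfl⟩
          · obtain rfl : j = j' := by omega
            right; right; right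
            exact ⟨⟨j, by omega⟩, h.1.symm, ⟨s, hsI⟩, by push_cast; rfl, by push_cast; rfl⟩
          · obtain rfl : j = j' := by omega
            left
            rw [mul_right_cancel h.1]
    · have := hbd g d hd
      rw [h, hint g' d' hd'] at this
      exact absurd this hd'
  · by_cases hd' : ‖(d' : ℂ)‖ = 1
    · have := hbd g' d' hd'
      rw [← h, hint g d hd] at this
      exact absurd this hd
    · rw [hint g d hd, hint g' d' hd'] at h
      exact Or.inl h

theorem isClosed_sheetNormalForm_eq [Finite G] [TopologicalSpace G] [DiscreteTopology G]
    (hk : 1 ≤ k) {y : ℕ → G} (hy : doubledProd y (2 * k) = 1) :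
    IsClosed {p : (G × PolygonDisk) × (G × PolygonDisk) |
      sheetNormalForm hk y p.1 = sheetNormalForm hk y p.2} := by
  have he := continuous_edge k
  have hset : {p : (G × PolygonDisk) × (G × PolygonDisk) |
      sheetNormalForm hk y p.1 = sheetNormalForm hk y p.2} =
      Set.diagonal (G × PolygonDisk) ∪
      (⋃ (g : G) (g' : G) (i : Fin (2 * k)) (i' : Fin (2 * k))
        (_ : g * doubledProd y i = g' * doubledProd y i'), {((g, edge k i), (g', edge k i'))}) ∪
      (⋃ (g : G) (g' : G) (j : Fin k)
        (_ : g * doubledProd y (2 * j) = g' * doubledProd y (2 * j + 1)),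
        Set.range fun s : unitInterval =>
          ((g, edge k (2 * (j : ℝ) + s)), (g', edge k (2 * (j : ℝ) + 1 + s)))) ∪
      (⋃ (g : G) (g' : G) (j : Fin k)
        (_ : g' * doubledProd y (2 * j) = g * doubledProd y (2 * j + 1)),
        Set.range fun s : unitInterval =>
          ((g, edge k (2 * (j : ℝ) + 1 + s)), (g', edge k (2 * (j : ℝ) + s)))) := by
    apply Set.Subset.antisymm
    · rintro ⟨⟨g, d⟩, ⟨g', d'⟩⟩ hp
      rcases eq_of_sheetNormalForm_eq hk y hp with h | ⟨i, i', h, rfl, rfl⟩ |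
        ⟨j, h, s, rfl, rfl⟩ | ⟨j, h, s, rfl, rfl⟩
      · exact Or.inl (Or.inl (Or.inl h))
      · refine Or.inl (Or.inl (Or.inr ?_))
        simp only [Set.mem_iUnion]
        exact ⟨g, g', i, i', h, rfl⟩
      · refine Or.inl (Or.inr ?_)
        simp only [Set.mem_iUnion]
        exact ⟨g, g', j, h, s, rfl⟩
      · refine Or.inr ?_
        simp only [Set.mem_iUnion]
        exact ⟨g, g', j, h, s, rfl⟩
    · rintro p (((h | h) | h) | h)
      · exact congrArg _ h
      · simp only [Set.mem_iUnion] at h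
        obtain ⟨g, g', i, i', h, rfl⟩ := h
        simp only [Set.mem_ofPred_eq, sheetNormalForm_vertex hk hy _ i.2.le,
          sheetNormalForm_vertex hk hy _ i'.2.le, h]
      · simp only [Set.mem_iUnion] at h
        obtain ⟨g, g', j, h, s, rfl⟩ := h
        exact sheetNormalForm_glue hk hy j.2 h s.2
      · simp only [Set.mem_iUnion] at h
        obtain ⟨g, g', j, h, s, rfl⟩ := h
        exact (sheetNormalForm_glue hk hy j.2 h s.2).symm
  rw [hset]
  refine ((isClosed_diagonal.union ?_).union ?_).union ?_
  · exact isClosed_iUnion_of_finite fun g => isClosed_iUnion_of_finite fun g' =>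
      isClosed_iUnion_of_finite fun i => isClosed_iUnion_of_finite fun i' =>
      isClosed_iUnion_of_finite fun _ => isClosed_singleton
  · exact isClosed_iUnion_of_finite fun g => isClosed_iUnion_of_finite fun g' =>
      isClosed_iUnion_of_finite fun j => isClosed_iUnion_of_finite fun _ =>
      (isCompact_range (by fun_prop)).isClosed
  · exact isClosed_iUnion_of_finite fun g => isClosed_iUnion_of_finite fun g' =>
      isClosed_iUnion_of_finite fun j => isClosed_iUnion_of_finite fun _ =>
      (isCompact_range (by fun_prop)).isClosed

end CrossCapSurface

end

/-! ### The covering with given holonomy, and the count of homomorphisms -/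

section

open Topology CategoryTheory

namespace CrossCapSurface

variable {k : ℕ} {G : Type*} [Group G]

/-- The `G`-covering of the surface with holonomy `y j` along the `j`-th edge. -/
def HolonomyCover (hk : 1 ≤ k) (y : ℕ → G) : Type _ :=
  Quotient (Setoid.ker (sheetNormalForm hk y))

namespace HolonomyCover

variable (hk : 1 ≤ k) (y : ℕ → G)

instance [TopologicalSpace G] : TopologicalSpace (HolonomyCover hk y) :=
  inferInstanceAs (TopologicalSpace (Quotient (Setoid.ker (sheetNormalForm hk y))))

/-- The point of the covering given by the point `d` of the sheet `g`. -/
noncomputable def mk (g : G) (d : PolygonDisk) : HolonomyCover hk y :=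
  Quotient.mk (Setoid.ker (sheetNormalForm hk y)) (g, d)

variable {hk y}

theorem mk_eq_mk {g g' : G} {d d' : PolygonDisk} :
    mk hk y g d = mk hk y g' d' ↔ sheetNormalForm hk y (g, d) = sheetNormalForm hk y (g', d') :=
  Quotient.eq

theorem ind {P : HolonomyCover hk y → Prop} (h : ∀ g d, P (mk hk y g d)) (e) : P e :=
  Quotient.inductionOn e fun p => h p.1 p.2

noncomputable instance : MulAction G (HolonomyCover hk y) where
  smul g e := Quotient.map (fun p : G × PolygonDisk => (g * p.1, p.2)) (by
    rintro ⟨a, d⟩ ⟨b, d'⟩ h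
    have h' : sheetNormalForm hk y (a, d) = sheetNormalForm hk y (b, d') := h
    change sheetNormalForm hk y (g * a, d) = sheetNormalForm hk y (g * b, d')
    rw [sheetNormalForm_mul, sheetNormalForm_mul, h']) e
  one_smul e := by
    induction e using ind with | _ g d => ?_
    exact congrArg (fun x => mk hk y x d) (one_mul g)
  mul_smul a b e := by
    induction e using ind with | _ g d => ?_
    exact congrArg (fun x => mk hk y x d) (mul_assoc a b g)

theorem smul_mk (a g : G) (d : PolygonDisk) : a • mk hk y g d = mk hk y (a * g) d := rfl

instance : IsCancelSMul G (HolonomyCover hk y) :=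
  isCancelSMul_iff_eq_one_of_smul_eq.2 fun a e h => by
    induction e using ind with | _ g d => ?_
    rw [smul_mk, mk_eq_mk, sheetNormalForm_mul] at h
    simpa using congrArg Prod.fst h

variable (hk y) in
/-- The covering map. -/
noncomputable def toSurface : HolonomyCover hk y → CrossCapSurface k :=
  Quotient.lift (fun p : G × PolygonDisk => proj k p.2) fun p q h => by
    rw [← proj_sheetNormalForm hk y p, ← proj_sheetNormalForm hk y q]
    exact congrArg (fun p => proj k p.2) (show sheetNormalForm hk y p = sheetNormalForm hk y q from h)

theorem toSurface_eq_iff (hy : doubledProd y (2 * k) = 1) {e e' : HolonomyCover hk y} :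
    toSurface hk y e = toSurface hk y e' ↔ e ∈ MulAction.orbit G e' := by
  constructor
  · induction e using ind with | _ g d => ?_
    induction e' using ind with | _ g' d' => ?_
    intro h
    refine ⟨(sheetNormalForm hk y (g, d)).1 * (sheetNormalForm hk y (g', d')).1⁻¹, ?_⟩
    change (_ : G) • mk hk y g' d' = _
    rw [smul_mk, mk_eq_mk, sheetNormalForm_mul]
    refine Prod.ext (by simp) (sheetNormalForm_snd_eq hk hy g g' h).symm
  · rintro ⟨a, rfl⟩
    induction e' using ind with | _ g' d' => ?_
    rfl

variable [TopologicalSpace G]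

theorem continuous_mk : Continuous fun p : G × PolygonDisk => mk hk y p.1 p.2 :=
  continuous_quot_mk

theorem isQuotientMap_toSurface : IsQuotientMap (toSurface hk y) := by
  have h : IsQuotientMap (toSurface hk y ∘ fun p : G × PolygonDisk => mk hk y p.1 p.2) :=
    (isQuotientMap_proj k).comp isQuotientMap_snd
  exact IsQuotientMap.of_comp continuous_mk
    (continuous_quot_lift _ ((proj k).continuous.comp continuous_snd)) h

variable [Finite G] [DiscreteTopology G]

/-- A finite group acting freely and continuously on a compact Hausdorff space acts properly
discontinuously, so the orbit map is a covering. -/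
theorem isQuotientCoveringMap (hy : doubledProd y (2 * k) = 1) :
    IsQuotientCoveringMap (toSurface hk y) G := by
  have : CompactSpace PolygonDisk := isCompact_iff_compactSpace.1 (isCompact_closedBall _ _)
  have : CompactSpace (HolonomyCover hk y) :=
    inferInstanceAs (CompactSpace (Quotient (Setoid.ker (sheetNormalForm hk y))))
  have : T2Space (HolonomyCover hk y) :=
    t2Space_quotient_of_isClosed _ (isClosed_sheetNormalForm_eq hk hy)
  have : ContinuousConstSMul G (HolonomyCover hk y) := ⟨fun a => by
    refine continuous_quot_lift _ ?_
    exact continuous_mk.comp (f := fun p : G × PolygonDisk => (a * p.1, p.2)) (by fun_prop)⟩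
  exact isQuotientMap_toSurface.isQuotientCoveringMap_of_properlyDiscontinuousSMul
    (toSurface_eq_iff hy)

end HolonomyCover

theorem exists_hom_edgeClass [Finite G] (hk : 1 ≤ k) {y : ℕ → G}
    (hy : doubledProd y (2 * k) = 1) :
    ∃ φ : FundamentalGroup (CrossCapSurface k) (vertex k) →* G,
      ∀ j < k, (φ (edgeClass hk j))⁻¹ = y j := by
  let _ : TopologicalSpace G := ⊥
  have : DiscreteTopology G := ⟨rfl⟩
  have hp := HolonomyCover.isQuotientCoveringMap (hk := hk) hy
  let e₀ : HolonomyCover.toSurface hk y ⁻¹' {vertex k} := ⟨.mk hk y 1 (edge k 0), rfl⟩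
  -- Monodromy takes values in the opposite group; inversion brings it back to `G`, which accounts
  -- for the inverse in the conclusion.
  refine ⟨(MulEquiv.inv' G).symm.toMonoidHom.comp (hp.fundamentalGroupToMulOpposite e₀),
    fun j hj => ?_⟩
  have key : hp.fundamentalGroupToMulOpposite e₀ (edgeClass hk j) = MulOpposite.op (y j) := by
    rw [hp.fundamentalGroupToMulOpposite_apply_eq_Iff]
    let e₁ : HolonomyCover.toSurface hk y ⁻¹' {vertex k} := ⟨.mk hk y (y j) (edge k 0), rfl⟩
    -- The `j`-th edge is lifted to the sheet `(doubledProd y (2 * j))⁻¹`, chosen so that the lift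
    -- starts at the base point; it then ends at the translate of the base point by `y j`.
    have h0 : HolonomyCover.mk hk y (doubledProd y (2 * j))⁻¹ (edge k (2 * (j : ℝ) + (0 : ℝ))) = e₀ := by
      have e1 := sheetNormalForm_vertex hk hy (doubledProd y (2 * j))⁻¹ (i := 2 * j) (by omega)
      have e2 := sheetNormalForm_vertex hk hy 1 (i := 0) (by omega)
      push_cast at e1 e2
      rw [HolonomyCover.mk_eq_mk, add_zero, e1, e2]
      simp [doubledProd]
    have h1 : HolonomyCover.mk hk y (doubledProd y (2 * j))⁻¹ (edge k (2 * (j : ℝ) + (1 : ℝ))) = e₁ := by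
      have e1 := sheetNormalForm_vertex hk hy (doubledProd y (2 * j))⁻¹ (i := 2 * j + 1) (by omega)
      have e2 := sheetNormalForm_vertex hk hy (y j) (i := 0) (by omega)
      push_cast at e1 e2
      rw [HolonomyCover.mk_eq_mk, e1, e2, doubledProd]
      simp [doubledProd, show 2 * j / 2 = j by omega]
    have hc := continuous_edge k
    let Γ : Path e₀.1 e₁.1 :=
      { toFun := fun s => HolonomyCover.mk hk y (doubledProd y (2 * j))⁻¹ (edge k (2 * (j : ℝ) + s))
        continuous_toFun := HolonomyCover.continuous_mk.comp
          (f := fun s : unitInterval => ((doubledProd y (2 * j))⁻¹, edge k (2 * (j : ℝ) + s)))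
          (by fun_prop)
        source' := h0
        target' := h1 }
    have hm := hp.isCoveringMap.monodromy_eq_of_map_eq (γ := edgeClass hk j) (ex := e₀) (ey := e₁)
      (Path.Homotopic.Quotient.mk Γ) rfl
    rw [hm]
    exact (HolonomyCover.smul_mk _ _ _).trans (by rw [mul_one]; rfl)
  simp [key]

/-- The locus where two homomorphisms agree is a subgroup containing the generators. -/
theorem edgeClass_hom_ext (hk : 1 ≤ k) {φ ψ : FundamentalGroup (CrossCapSurface k) (vertex k) →* G}
    (h : ∀ j < k, φ (edgeClass hk j) = ψ (edgeClass hk j)) : φ = ψ := by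
  have : φ.eqLocus ψ = ⊤ := eq_top_of_edgeClass_mem hk h
  exact MonoidHom.eq_of_eqOn_top fun x _ => by
    have hx : x ∈ φ.eqLocus ψ := this ▸ Subgroup.mem_top x
    exact hx

theorem card_hom_vertex [Finite G] (hk : 1 ≤ k) :
    Nat.card (FundamentalGroup (CrossCapSurface k) (vertex k) →* G) =
      Nat.card {x : Fin k → G // (List.ofFn fun i => x i ^ 2).prod = 1} := by
  refine Nat.card_congr (Equiv.ofBijective
    (fun φ => ⟨fun j => (φ (edgeClass hk j))⁻¹, prod_map_edgeClass hk φ⟩) ⟨?_, ?_⟩)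
  · intro φ ψ h
    refine edgeClass_hom_ext hk fun j hj => ?_
    exact inv_injective (congrFun (congrArg Subtype.val h) ⟨j, hj⟩)
  · rintro ⟨x, hx⟩
    obtain ⟨φ, hφ⟩ := exists_hom_edgeClass hk
      (y := fun j => if h : j < k then x ⟨j, h⟩ else 1) (by
        rw [doubledProd_two_mul]
        simpa using hx)
    refine ⟨φ, Subtype.ext (funext fun j => ?_)⟩
    simpa using hφ j j.2

theorem card_hom_fundamentalGroup [Finite G] {S : Type*} [TopologicalSpace S]
    (hS : IsNonorientableSurface k S) (s : S) :
    Nat.card (FundamentalGroup S s →* G) =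
      Nat.card {x : Fin k → G // (List.ofFn fun i => x i ^ 2).prod = 1} := by
  obtain ⟨hk, ⟨f⟩⟩ := hS
  rw [← card_hom_vertex hk]
  have : PathConnectedSpace (CrossCapSurface k) :=
    (isQuotientMap_proj k).surjective.pathConnectedSpace (proj k).continuous
  let e : FundamentalGroup S s ≃* FundamentalGroup (CrossCapSurface k) (f s) :=
    (FundamentalGroupoidFunctor.equivOfHomotopyEquiv
      f.toHomotopyEquiv).fullyFaithfulFunctor.mulEquivEnd (FundamentalGroupoid.mk s)
  exact Nat.card_congr (MulEquiv.monoidHomCongrLeftEquiv (e.trans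
    (FundamentalGroup.fundamentalGroupMulEquivOfPathConnected (f s) (vertex k))))

end CrossCapSurface

end

/-! ### Completeness of the irreducible characters -/

section

open scoped MonoidAlgebra

namespace ComplexIrrep

variable {G : Type*} [Group G] (V : ComplexIrrep G)

theorem exists_eq_smul_one (T : (Fin V.n → ℂ) →ₗ[ℂ] (Fin V.n → ℂ))
    (hT : ∀ g, T * V.ρ g = V.ρ g * T) : ∃ c : ℂ, T = c • 1 := by
  have := V.irreducible
  let f : Representation.IntertwiningMap V.ρ V.ρ := ⟨T, hT⟩
  obtain ⟨c, hc⟩ :=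
    (Representation.IsIrreducible.algebraMap_intertwiningMap_bijective_of_isAlgClosed
      (ρ := V.ρ)).2 f
  refine ⟨c, ?_⟩
  have h2 : (algebraMap ℂ (Representation.IntertwiningMap V.ρ V.ρ) c).toLinearMap = T := by rw [hc]
  rw [← h2]
  rfl

theorem n_ne_zero : V.n ≠ 0 := by
  intro h
  obtain ⟨n, ρ, hρ⟩ := V
  simp only at h
  subst h
  obtain ⟨⟨a, b, hab⟩⟩ := hρ.toNontrivial
  exact hab (Subrepresentation.toSubmodule_injective (Subsingleton.elim _ _))

/-- A simple module over the group algebra, of finite dimension over `ℂ`, comes from an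
irreducible representation on a coordinate space. -/
theorem exists_equiv_of_isSimpleModule (W : Type*) [AddCommGroup W] [Module ℂ W] [Module ℂ[G] W]
    [IsScalarTower ℂ ℂ[G] W] [FiniteDimensional ℂ W] [IsSimpleModule ℂ[G] W] :
    ∃ (V : ComplexIrrep G) (e : W ≃ₗ[ℂ] (Fin V.n → ℂ)),
      ∀ g w, e (MonoidAlgebra.of ℂ G g • w) = V.ρ g (e w) := by
  let e : W ≃ₗ[ℂ] (Fin (Module.finrank ℂ W) → ℂ) := (Module.finBasis ℂ W).equivFun
  let ρ : Representation ℂ G (Fin (Module.finrank ℂ W) → ℂ) :=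
    { toFun := fun g => e.toLinearMap ∘ₗ
        (Module.toModuleEnd ℂ (S := ℂ[G]) W (MonoidAlgebra.of ℂ G g)) ∘ₗ e.symm.toLinearMap
      map_one' := by
        rw [map_one, map_one]
        ext
        simp
      map_mul' := fun g h => by
        rw [map_mul, map_mul]
        ext
        simp }
  have hρ : ∀ g w, e (MonoidAlgebra.of ℂ G g • w) = ρ g (e w) := fun g w => by simp [ρ]
  have hA : ∀ (a : ℂ[G]) (w : W), e (a • w) = ρ.asAlgebraHom a (e w) := by
    intro a w
    induction a using MonoidAlgebra.induction_on with
    | of g => rw [hρ]; simp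
    | add a b ha hb => rw [add_smul, map_add, ha, hb, map_add, LinearMap.add_apply]
    | smul r a ha => rw [smul_assoc, map_smul, ha, map_smul, LinearMap.smul_apply]
  let e' : W ≃ₗ[ℂ[G]] ρ.asModule :=
    { e.toAddEquiv.trans ρ.asModuleEquiv.symm.toAddEquiv with
      map_smul' := fun a w => by
        apply ρ.asModuleEquiv.injective
        rw [RingHom.id_apply, Representation.asModuleEquiv_map_smul]
        exact hA a w }
  have : IsSimpleModule ℂ[G] ρ.asModule := IsSimpleModule.congr e'.symm
  exact ⟨⟨_, ρ, (Representation.irreducible_iff_isSimpleModule_asModule ρ).2 this⟩, e, hρ⟩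

variable [Fintype G]

/-- A class function acts by an intertwiner, hence by a scalar, and the scalar is detected by its
trace since `V.n` is nonzero. -/
theorem sum_smul_eq_zero {f : G → ℂ} (hf : ∀ g h, f (h * g * h⁻¹) = f g)
    (hV : ∑ g, f g * V.ρ.character g = 0) : ∑ g, f g • V.ρ g = 0 := by
  obtain ⟨c, hc⟩ := V.exists_eq_smul_one (∑ g, f g • V.ρ g) (by
    intro h
    rw [Finset.sum_mul, Finset.mul_sum]
    refine Fintype.sum_equiv (MulAut.conj h⁻¹).toEquiv _ _ fun g => ?_
    simp only [MulEquiv.toEquiv_eq_coe, EquivLike.coe_coe, MulAut.conj_apply]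
    rw [hf, smul_mul_assoc, mul_smul_comm, ← map_mul, ← map_mul]
    congr 2
    group)
  have h := congrArg (LinearMap.trace ℂ _) hc
  rw [map_sum, map_smul, LinearMap.trace_one] at h
  simp only [map_smul, smul_eq_mul] at h
  have h' : (0 : ℂ) = c * V.n := by
    rw [← hV]
    simpa [Representation.character] using h
  have : c = 0 := by
    rcases mul_eq_zero.1 h'.symm with h | h
    · exact h
    · exact absurd (by exact_mod_cast h) V.n_ne_zero
  rw [hc, this, zero_smul]

/-- The element `∑ f g • g` of the group algebra annihilates every simple submodule. By Maschke's
theorem these span the group algebra, so it annihilates `1` and vanishes. -/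
theorem eq_zero_of_sum_character_eq_zero {f : G → ℂ} (hf : ∀ g h, f (h * g * h⁻¹) = f g)
    (h0 : ∀ V : ComplexIrrep G, ∑ g, f g * V.ρ.character g = 0) (g : G) : f g = 0 := by
  classical
  let z : ℂ[G] := ∑ g, f g • MonoidAlgebra.of ℂ G g
  have : NeZero (Nat.card G : ℂ) := ⟨Nat.cast_ne_zero.2 Nat.card_pos.ne'⟩
  have hz : z ∈ Submodule.annihilator (⊤ : Submodule ℂ[G] ℂ[G]) := by
    rw [← IsSemisimpleModule.sSup_simples_eq_top ℂ[G] ℂ[G], sSup_eq_iSup',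
      Submodule.annihilator_iSup]
    rw [Submodule.mem_iInf]
    rintro ⟨N, hN⟩
    have hN' : IsSimpleModule ℂ[G] N := hN
    have : FiniteDimensional ℂ ℂ[G] := inferInstance
    have : FiniteDimensional ℂ N :=
      FiniteDimensional.of_injective ((N.subtype).restrictScalars ℂ) N.injective_subtype
    obtain ⟨V, e, he⟩ := exists_equiv_of_isSimpleModule (G := G) N
    rw [Submodule.mem_annihilator]
    intro w hw
    have h1 : z • (⟨w, hw⟩ : N) = 0 := by
      apply e.injective
      have h2 := congrArg (fun T => T (e ⟨w, hw⟩)) (V.sum_smul_eq_zero hf (h0 V))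
      simp only [LinearMap.sum_apply, LinearMap.smul_apply, LinearMap.zero_apply] at h2
      rw [map_zero, ← h2, Finset.sum_smul, map_sum]
      refine Finset.sum_congr rfl fun g _ => ?_
      rw [smul_assoc, map_smul, he]
    exact congrArg Subtype.val h1
  have hz0 : z = 0 := by
    have := Submodule.mem_annihilator.1 hz 1 trivial
    simpa using this
  have := congrArg (fun a : ℂ[G] => a.coeff g) hz0
  simpa [z, MonoidAlgebra.coeff_sum, Finsupp.single_apply] using this

end ComplexIrrep

namespace IrrepClass

variable {G : Type*} [Group G]

theorem character_conj (c : IrrepClass G) (g h : G) : c.character (h * g * h⁻¹) = c.character g := by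
  induction c using Quotient.inductionOn with | _ V => ?_
  exact Representation.char_conj _ _ _

theorem character_one (c : IrrepClass G) : c.character 1 = c.dim := by
  induction c using Quotient.inductionOn with | _ V => ?_
  exact (Representation.char_one _).trans (by rw [Module.finrank_fin_fun]; rfl)

-- The difference of the two sides is a class function orthogonal to every irreducible character.
open scoped Classical in
theorem sum_dim_mul_character [Fintype G] [Fintype (IrrepClass G)] (g : G) :
    ∑ c : IrrepClass G, (c.dim : ℂ) * c.character g = if g = 1 then (Fintype.card G : ℂ) else 0 := by
  have hG : (Nat.card G : ℂ) ≠ 0 := Nat.cast_ne_zero.2 Nat.card_pos.ne'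
  -- The function is taken at `g⁻¹` because orthonormality pairs `g` with `g⁻¹`.
  have key := ComplexIrrep.eq_zero_of_sum_character_eq_zero (G := G)
    (f := fun g => (if g⁻¹ = 1 then (Fintype.card G : ℂ) else 0) -
      ∑ c : IrrepClass G, (c.dim : ℂ) * c.character g⁻¹) ?_ ?_ g⁻¹
  · simp only [inv_inv] at key
    exact (sub_eq_zero.1 key).symm
  · intro g h
    have e : (h * g * h⁻¹)⁻¹ = h * g⁻¹ * h⁻¹ := by group
    rw [e]
    simp only [character_conj]
    congr 2
    rw [conj_eq_one_iff]
  · intro V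
    let d : IrrepClass G := Quotient.mk _ V
    change ∑ g, _ * d.character g = 0
    simp only [sub_mul, Finset.sum_sub_distrib, Finset.sum_mul]
    rw [Finset.sum_comm]
    have h1 : ∀ c : IrrepClass G, ∑ g, (c.dim : ℂ) * c.character g⁻¹ * d.character g =
        c.dim * (Nat.card G * if c = d then 1 else 0) := by
      intro c
      rw [← character_orthonormal d c, mul_inv_cancel_left₀ hG, Finset.mul_sum]
      exact Finset.sum_congr rfl fun g _ => by ring
    simp only [h1]
    simp [character_one, mul_comm]

end IrrepClass

end

/-! ### The Frobenius–Schur indicator and the count of products of squares -/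

section

open Matrix

namespace ComplexIrrep

variable {G : Type*} [Group G] (V : ComplexIrrep G)

/-- The matrix of the action of a group element. -/
noncomputable def mat (g : G) : Matrix (Fin V.n) (Fin V.n) ℂ := LinearMap.toMatrix' (V.ρ g)

theorem mat_mul (g h : G) : V.mat (g * h) = V.mat g * V.mat h := by
  rw [mat, map_mul, Module.End.mul_eq_comp, LinearMap.toMatrix'_comp]
  rfl

theorem mat_one : V.mat 1 = 1 := by
  rw [mat, map_one]
  exact LinearMap.toMatrix'_id

theorem character_eq_trace (g : G) : V.ρ.character g = (V.mat g).trace := by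
  rw [Representation.character, mat, LinearMap.trace_eq_matrix_trace ℂ (Pi.basisFun ℂ (Fin V.n)),
    LinearMap.toMatrix_eq_toMatrix']

/-- The matrix `B` is the Gram matrix of an invariant bilinear form. -/
def IsInvariantForm (B : Matrix (Fin V.n) (Fin V.n) ℂ) : Prop :=
  ∀ g, (V.mat g)ᵀ * B * V.mat g = B

variable {V}

/-- The radical of an invariant form is a subrepresentation, hence zero or everything. -/
theorem IsInvariantForm.isUnit {B : Matrix (Fin V.n) (Fin V.n) ℂ} (hB : V.IsInvariantForm B)
    (h0 : B ≠ 0) : IsUnit B := by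
  have := V.irreducible
  rw [← Matrix.mulVec_injective_iff_isUnit]
  let K : Subrepresentation V.ρ :=
    { toSubmodule := LinearMap.ker (Matrix.toLin' B)
      apply_mem_toSubmodule := fun g v hv => by
        rw [LinearMap.mem_ker, Matrix.toLin'_apply] at hv ⊢
        have h1 : V.ρ g v = V.mat g *ᵥ v := by
          rw [mat, ← Matrix.toLin'_apply, Matrix.toLin'_toMatrix']
        have h2 : B * V.mat g = (V.mat g⁻¹)ᵀ * B := by
          have h3 : (V.mat g⁻¹)ᵀ * (V.mat g)ᵀ = 1 := by
            rw [← Matrix.transpose_mul, ← mat_mul, mul_inv_cancel, mat_one, Matrix.transpose_one]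
          conv_rhs => rw [← hB g]
          rw [← Matrix.mul_assoc, ← Matrix.mul_assoc, h3, Matrix.one_mul]
        rw [h1, Matrix.mulVec_mulVec, h2, ← Matrix.mulVec_mulVec, hv, Matrix.mulVec_zero] }
  rcases eq_bot_or_eq_top K with h | h
  · have hk : LinearMap.ker (Matrix.toLin' B) = ⊥ := congrArg Subrepresentation.toSubmodule h
    exact LinearMap.ker_eq_bot.1 hk
  · have hk : LinearMap.ker (Matrix.toLin' B) = ⊤ := congrArg Subrepresentation.toSubmodule h
    rw [LinearMap.ker_eq_top] at hk
    exact absurd ((LinearEquiv.map_eq_zero_iff _).1 hk) h0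

/-- `B⁻¹ * C` commutes with the action, so Schur's lemma applies. -/
theorem IsInvariantForm.eq_smul {B C : Matrix (Fin V.n) (Fin V.n) ℂ} (hB : V.IsInvariantForm B)
    (h0 : B ≠ 0) (hC : V.IsInvariantForm C) : ∃ c : ℂ, C = c • B := by
  have hu := hB.isUnit h0
  have hdet : IsUnit B.det := (Matrix.isUnit_iff_isUnit_det B).1 hu
  obtain ⟨c, hc⟩ := V.exists_eq_smul_one (Matrix.toLin' (B⁻¹ * C)) (by
    intro g
    have h1 : B⁻¹ * C * V.mat g = V.mat g * (B⁻¹ * C) := by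
      have h3 : (V.mat g⁻¹)ᵀ * (V.mat g)ᵀ = 1 := by
        rw [← Matrix.transpose_mul, ← mat_mul, mul_inv_cancel, mat_one, Matrix.transpose_one]
      have h4 : ∀ D, V.IsInvariantForm D → D * V.mat g = (V.mat g⁻¹)ᵀ * D := by
        intro D hD
        conv_rhs => rw [← hD g]
        rw [← Matrix.mul_assoc, ← Matrix.mul_assoc, h3, Matrix.one_mul]
      have h5 : B * (B⁻¹ * C * V.mat g) = B * (V.mat g * (B⁻¹ * C)) := by
        rw [← Matrix.mul_assoc, ← Matrix.mul_assoc, Matrix.mul_nonsing_inv B hdet, Matrix.one_mul,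
          h4 C hC, ← Matrix.mul_assoc, h4 B hB, Matrix.mul_assoc, ← Matrix.mul_assoc B,
          Matrix.mul_nonsing_inv B hdet, Matrix.one_mul]
      exact hu.mul_left_cancel h5
    apply LinearMap.toMatrix'.injective
    rw [Module.End.mul_eq_comp, Module.End.mul_eq_comp, LinearMap.toMatrix'_comp,
      LinearMap.toMatrix'_comp, LinearMap.toMatrix'_toLin']
    exact h1)
  refine ⟨c, ?_⟩
  have h := congrArg LinearMap.toMatrix' hc
  rw [LinearMap.toMatrix'_toLin', map_smul] at h
  have h1 : LinearMap.toMatrix' (1 : (Fin V.n → ℂ) →ₗ[ℂ] (Fin V.n → ℂ)) = 1 :=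
    LinearMap.toMatrix'_id
  rw [h1] at h
  have h2 := congrArg (fun M => B * M) h
  simp only [← Matrix.mul_assoc, Matrix.mul_nonsing_inv B hdet, Matrix.one_mul, Matrix.mul_smul,
    Matrix.mul_one] at h2
  exact h2

theorem IsInvariantForm.transpose {B : Matrix (Fin V.n) (Fin V.n) ℂ} (hB : V.IsInvariantForm B) :
    V.IsInvariantForm Bᵀ := by
  intro g
  have := congrArg Matrix.transpose (hB g)
  rw [Matrix.transpose_mul, Matrix.transpose_mul, Matrix.transpose_transpose,
    ← Matrix.mul_assoc] at this
  exact this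

variable (V) [Fintype G]

/-- The invariant form obtained by averaging the `(i, j)` matrix unit. -/
noncomputable def averagedForm (i j : Fin V.n) : Matrix (Fin V.n) (Fin V.n) ℂ :=
  Matrix.of fun a b => ∑ g, V.mat g i a * V.mat g j b

theorem sum_smul_averagedForm (B : Matrix (Fin V.n) (Fin V.n) ℂ) :
    ∑ i, ∑ j, B i j • V.averagedForm i j = ∑ g, (V.mat g)ᵀ * B * V.mat g := by
  ext a b
  simp only [Matrix.sum_apply, Matrix.smul_apply, averagedForm, Matrix.of_apply, smul_eq_mul,
    Matrix.mul_apply, Matrix.transpose_apply, Finset.mul_sum, Finset.sum_mul]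
  simp only [Finset.sum_comm (t := (Finset.univ : Finset G))]
  refine Finset.sum_congr rfl fun g _ => ?_
  rw [Finset.sum_comm]
  exact Finset.sum_congr rfl fun i _ => Finset.sum_congr rfl fun j _ => by ring

theorem isInvariantForm_averagedForm (i j : Fin V.n) : V.IsInvariantForm (V.averagedForm i j) := by
  classical
  have h : V.averagedForm i j = ∑ g, (V.mat g)ᵀ * Matrix.single i j 1 * V.mat g := by
    rw [← sum_smul_averagedForm]
    simp [Matrix.single_apply, Finset.sum_ite_eq, ite_and]
  intro g
  rw [h, Matrix.mul_sum, Matrix.sum_mul]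
  refine Fintype.sum_equiv (Equiv.mulRight g) _ _ fun x => ?_
  simp only [Equiv.coe_mulRight, mat_mul, Matrix.transpose_mul, Matrix.mul_assoc]

theorem sum_character_sq : ∑ w : G, V.ρ.character (w ^ 2) =
    ∑ i, ∑ j, V.averagedForm i j j i := by
  simp only [averagedForm, Matrix.of_apply, character_eq_trace, pow_two, mat_mul, Matrix.trace,
    Matrix.diag_apply, Matrix.mul_apply]
  simp only [Finset.sum_comm (s := (Finset.univ : Finset G))]

/-- All averaged forms are multiples `c i j • B` of one invariant form, if a nonzero one exists.
Transposition gives `Bᵀ = ε B` with `ε = ±1`. Averaging `B` itself shows `∑ B i j * c i j = |G|`,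
and the sum in question is the same with `B j i` for `B i j`, that is `ε |G|`. -/
theorem sum_character_sq_trichotomy :
    ∑ w : G, V.ρ.character (w ^ 2) = 0 ∨ ∑ w : G, V.ρ.character (w ^ 2) = Fintype.card G ∨
      ∑ w : G, V.ρ.character (w ^ 2) = -Fintype.card G := by
  rw [sum_character_sq]
  by_cases h : ∃ B, V.IsInvariantForm B ∧ B ≠ 0
  · right
    obtain ⟨B, hB, h0⟩ := h
    choose c hc using fun i j => hB.eq_smul h0 (V.isInvariantForm_averagedForm i j)
    obtain ⟨ε, hε⟩ := hB.eq_smul h0 hB.transpose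
    have hsmul : ∀ a b : ℂ, a • B = b • B → a = b := fun a b hab => smul_left_injective ℂ h0 hab
    have hε2 : ε * ε = 1 := by
      apply hsmul
      rw [mul_smul, ← hε, one_smul]
      have := congrArg Matrix.transpose hε
      rw [Matrix.transpose_transpose, Matrix.transpose_smul] at this
      exact this.symm
    have hsum : ∑ i, ∑ j, B i j * c i j = Fintype.card G := by
      apply hsmul
      have h1 := V.sum_smul_averagedForm B
      simp only [hc, smul_smul, ← Finset.sum_smul] at h1
      rw [h1, Finset.sum_congr rfl fun g _ => hB g]
      simp [← Nat.cast_smul_eq_nsmul ℂ]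
    have htot : ∑ i, ∑ j, V.averagedForm i j j i = ε * Fintype.card G := by
      rw [← hsum, Finset.mul_sum]
      refine Finset.sum_congr rfl fun i _ => ?_
      rw [Finset.mul_sum]
      refine Finset.sum_congr rfl fun j _ => ?_
      have h2 : B j i = ε * B i j := congrFun (congrFun hε i) j
      rw [hc, Matrix.smul_apply, smul_eq_mul, h2]
      ring
    rw [htot]
    rcases mul_self_eq_one_iff.1 hε2 with h | h
    · left; rw [h, one_mul]
    · right; rw [h, neg_one_mul]
  · left
    refine Finset.sum_eq_zero fun i _ => Finset.sum_eq_zero fun j _ => ?_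
    have : V.averagedForm i j = 0 := by
      by_contra h'
      exact h ⟨_, V.isInvariantForm_averagedForm i j, h'⟩
    rw [this]
    rfl

theorem sum_prod_sq (k : ℕ) : ∑ x : Fin k → G, V.ρ (List.ofFn fun i => x i ^ 2).prod =
    (∑ w : G, V.ρ (w ^ 2)) ^ k := by
  induction k with
  | zero => simp
  | succ k ih =>
    rw [← (Fin.consEquiv fun _ => G).sum_comp, Fintype.sum_prod_type, pow_succ', Finset.sum_mul]
    refine Finset.sum_congr rfl fun w _ => ?_
    rw [← ih, Finset.mul_sum]
    refine Finset.sum_congr rfl fun x _ => ?_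
    rw [List.ofFn_succ, List.prod_cons, map_mul]
    simp [Fin.consEquiv]

/-- The operator `∑ w, ρ (w ^ 2)` commutes with the action, so it is a scalar determined by its
trace; both sides are the trace of its `k`-th power. -/
theorem sum_character_prod_sq (k : ℕ) :
    ∑ x : Fin k → G, V.ρ.character (List.ofFn fun i => x i ^ 2).prod =
      V.n * ((∑ w : G, V.ρ.character (w ^ 2)) / V.n) ^ k := by
  have hn : (V.n : ℂ) ≠ 0 := Nat.cast_ne_zero.2 V.n_ne_zero
  obtain ⟨c, hc⟩ := V.exists_eq_smul_one (∑ w : G, V.ρ (w ^ 2)) (by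
    intro h
    rw [Finset.sum_mul, Finset.mul_sum]
    refine Fintype.sum_equiv (MulAut.conj h⁻¹).toEquiv _ _ fun g => ?_
    simp only [MulEquiv.toEquiv_eq_coe, EquivLike.coe_coe, MulAut.conj_apply]
    rw [← map_mul, ← map_mul]
    congr 1
    simp only [pow_two]
    group)
  have htr : ∑ w : G, V.ρ.character (w ^ 2) = c * V.n := by
    have h := congrArg (LinearMap.trace ℂ _) hc
    rw [map_sum, map_smul, LinearMap.trace_one] at h
    simpa [Representation.character] using h
  have h := congrArg (LinearMap.trace ℂ _) (V.sum_prod_sq k)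
  rw [hc, smul_pow, one_pow, map_sum, map_smul, LinearMap.trace_one] at h
  rw [htr, mul_div_cancel_right₀ _ hn]
  simpa [Representation.character, mul_comm] using h

end ComplexIrrep

namespace IrrepClass

variable {G : Type*} [Group G]

theorem dim_ne_zero (c : IrrepClass G) : c.dim ≠ 0 := by
  induction c using Quotient.inductionOn with | _ V => ?_
  exact V.n_ne_zero

variable [Fintype G]

theorem indicator_trichotomy (c : IrrepClass G) :
    c.indicator = 0 ∨ c.indicator = 1 ∨ c.indicator = -1 := by
  have hG : (Fintype.card G : ℂ) ≠ 0 := Nat.cast_ne_zero.2 Fintype.card_ne_zero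
  induction c using Quotient.inductionOn with | _ V => ?_
  rcases V.sum_character_sq_trichotomy with h | h | h
  · left
    exact (congrArg _ h).trans (mul_zero _)
  · right; left
    exact (congrArg _ h).trans (by field_simp)
  · right; right
    exact (congrArg _ h).trans (by field_simp)

theorem sum_character_prod_sq (c : IrrepClass G) (k : ℕ) :
    ∑ x : Fin k → G, c.character (List.ofFn fun i => x i ^ 2).prod =
      c.dim * (Fintype.card G * c.indicator / c.dim) ^ k := by
  have hG : (Fintype.card G : ℂ) ≠ 0 := Nat.cast_ne_zero.2 Fintype.card_ne_zero
  have h : Fintype.card G * c.indicator = ∑ w : G, c.character (w ^ 2) := by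
    rw [indicator, ← mul_assoc, mul_one_div_cancel hG, one_mul]
  rw [h]
  induction c using Quotient.inductionOn with | _ V => ?_
  exact V.sum_character_prod_sq k

/-- The Frobenius–Schur count of the solutions of `x₁² ⋯ xₖ² = 1`. -/
theorem card_prod_sq_eq_one [Fintype (IrrepClass G)] (k : ℕ) :
    (Fintype.card G : ℂ) * Nat.card {x : Fin k → G // (List.ofFn fun i => x i ^ 2).prod = 1} =
      (Fintype.card G : ℂ) ^ k * ∑ c : IrrepClass G, (c.dim : ℂ) ^ 2 * (c.indicator / c.dim) ^ k := by
  classical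
  calc (Fintype.card G : ℂ) * Nat.card {x : Fin k → G // (List.ofFn fun i => x i ^ 2).prod = 1}
      = ∑ x : Fin k → G, if (List.ofFn fun i => x i ^ 2).prod = 1 then (Fintype.card G : ℂ)
          else 0 := by
        rw [Nat.card_eq_fintype_card, Fintype.card_subtype, ← Finset.sum_filter, Finset.sum_const,
          nsmul_eq_mul, mul_comm]
    _ = ∑ c : IrrepClass G, (c.dim : ℂ) *
          ∑ x : Fin k → G, c.character (List.ofFn fun i => x i ^ 2).prod := by
        simp only [← sum_dim_mul_character, Finset.mul_sum]
        exact Finset.sum_comm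
    _ = _ := by
        rw [Finset.mul_sum]
        refine Finset.sum_congr rfl fun c _ => ?_
        rw [sum_character_prod_sq, mul_div_assoc, mul_pow]
        ring

end IrrepClass

theorem finsum_dim_zpow_eq {G : Type*} [Group G] [Fintype G] {k : ℕ} (hk : 1 ≤ k) :
    (∑ᶠ c ∈ realIrreps G, (c.dim : ℚ) ^ nonorientableEulerChar k)
        + (∑ᶠ c ∈ quaternionicIrreps G, (-(c.dim : ℚ)) ^ nonorientableEulerChar k)
      = (Fintype.card G : ℚ) ^ (nonorientableEulerChar k - 1)
          * (Nat.card {x : Fin k → G // (List.ofFn fun i => x i ^ 2).prod = 1} : ℚ) := by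
  classical
  have := Fintype.ofFinite (IrrepClass G)
  have hG : (Fintype.card G : ℂ) ≠ 0 := Nat.cast_ne_zero.2 Fintype.card_ne_zero
  have hcount := IrrepClass.card_prod_sq_eq_one (G := G) k
  have hz : (Fintype.card G : ℂ) ^ (nonorientableEulerChar k - 1) =
      Fintype.card G / (Fintype.card G : ℂ) ^ k := by
    rw [show nonorientableEulerChar k - 1 = 1 - (k : ℤ) by unfold nonorientableEulerChar; ring,
      zpow_sub₀ hG, zpow_one, zpow_natCast]
  rw [finsum_mem_def, finsum_mem_def, finsum_eq_sum_of_fintype, finsum_eq_sum_of_fintype,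
    ← Finset.sum_add_distrib]
  -- The indicators are complex numbers, so the rational identity is verified in `ℂ`, class by
  -- class.
  apply (Rat.cast_injective (α := ℂ))
  push_cast
  rw [hz, div_mul_eq_mul_div, hcount, mul_div_cancel_left₀ _ (pow_ne_zero k hG)]
  refine Finset.sum_congr rfl fun c _ => ?_
  have hd : (c.dim : ℂ) ≠ 0 := Nat.cast_ne_zero.2 c.dim_ne_zero
  have hzd : ∀ a : ℂ, a ≠ 0 → a ^ nonorientableEulerChar k = a ^ 2 * (1 / a) ^ k := by
    intro a ha
    rw [nonorientableEulerChar, zpow_sub₀ ha, zpow_natCast, one_div, inv_pow]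
    rfl
  have h1 : (1 : ℂ) ≠ -1 := by norm_num
  rcases c.indicator_trichotomy with h | h | h
  · have hr : c ∉ realIrreps G := by simp [realIrreps, h]
    have hq : c ∉ quaternionicIrreps G := by simp [quaternionicIrreps, h]
    -- Classes of indicator `0` drop out because `0 ^ k = 0`, which needs `1 ≤ k`.
    rw [Set.indicator_of_notMem hr, Set.indicator_of_notMem hq, h, zero_div,
      zero_pow (by omega)]
    simp
  · have hr : c ∈ realIrreps G := h
    have hq : c ∉ quaternionicIrreps G := fun hc => h1 (h.symm.trans hc)
    rw [Set.indicator_of_mem hr, Set.indicator_of_notMem hq, h, ← hzd _ hd]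
    simp
  · have hr : c ∉ realIrreps G := fun hc => h1 (Eq.trans (Eq.symm hc) h)
    have hq : c ∈ quaternionicIrreps G := h
    rw [Set.indicator_of_notMem hr, Set.indicator_of_mem hq, h]
    push_cast
    -- The sign `(-1) ^ k` of the quaternionic term is absorbed into the base, since `(-dim)²`
    -- equals `dim²`.
    rw [hzd _ (neg_ne_zero.2 hd), neg_sq, zero_add, one_div, inv_neg, neg_div, one_div]

end

theorem mainTheorem6 {G : Type*} [Group G] [Fintype G] {S : Type*} [TopologicalSpace S]
    (k : ℕ) (hS : IsNonorientableSurface k S) (s : S) :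
    (∑ᶠ c ∈ realIrreps G, (c.dim : ℚ) ^ nonorientableEulerChar k)
        + (∑ᶠ c ∈ quaternionicIrreps G, (-(c.dim : ℚ)) ^ nonorientableEulerChar k)
      = (Fintype.card G : ℚ) ^ (nonorientableEulerChar k - 1)
          * (Nat.card (FundamentalGroup S s →* G) : ℚ)
    ∧ Nat.card (FundamentalGroup S s →* G)
      = Nat.card {x : Fin k → G // (List.ofFn fun i => x i ^ 2).prod = 1} := by
  have h := CrossCapSurface.card_hom_fundamentalGroup (G := G) hS s
  exact ⟨by rw [h]; exact finsum_dim_zpow_eq hS.1, h⟩
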